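/- Let $n_X,n_z,n_U\in\mathbb{N}$. Let $\mathcal X=\mathbb{R}^{n_X}\times L^2((0,1);\mathbb{R}^{n_z})$ and $\mathcal Y=\mathbb{R}^{n_X}\times H^1((0,1);\mathbb{R}^{n_z})$, with $\|(Z,\zeta)\|_{\mathcal X}^2=\|Z\|_2^2+\|\zeta\|_{L^2}^2$, $\|(Z,\zeta)\|_{\mathcal Y}^2=\|Z\|_2^2+\|\zeta\|_{L^2}^2+\|\partial_\xi\zeta\|_{L^2}^2$, and let $\mathscr D(\mathscr A)=\{(Z,\zeta)\in\mathcal Y : \zeta(0)=0\}$. Consider the ODE-PDE system, for $t>0$ and $\xi\in(0,1)$, $$\dot X=A_1X+G_1\mathscr K_1z+G_1\Theta\Sigma(v)\mathscr K_2z+G_1h_1(v),\qquad \partial_tz+\Lambda\,\partial_\xi z=\Theta\Sigma(v)z+h_2(v),\qquad z(0,t)=0,$$ where $v=v(X(t),U(t))=A_2X(t)+G_2U(t)$; the matrices $A_1,A_2,G_1,G_2$ are constant of compatible sizes; $\Lambda=\mathrm{diag}(\lambda_i)$ and $\Theta=\mathrm{diag}(\theta_i)$ with all $\lambda_i,\theta_i>0$;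 $\Sigma:\mathbb{R}^{n_z}\to\mathbf M_{n_z}(\mathbb{R})$, $h_1:\mathbb{R}^{n_z}\to\mathbb{R}^{n_z}$, and $h_2:\mathbb{R}^{n_z}\to\mathbb{R}^{n_z}$ is invertible; and $\mathscr K_1\zeta=\int_0^1K_1\zeta\,d\xi+K_2\zeta(1)$, $\mathscr K_2\zeta=\int_0^1K_3\zeta\,d\xi$ with $K_1,K_3\in C^0([0,1];\mathbf M_{n_z}(\mathbb{R}))$ and $K_2\in\mathbf M_{n_z}(\mathbb{R})$. Measurements and parameter estimation: let $Y_1=h_2(v)$, $Y_2=\Theta\Lambda\Sigma(h_2^{-1}(Y_1))\Lambda^{-1}Y_1+\dot Y_1$, $Z_i=1^{\mathrm T}Y_i$, $\phi=-\Lambda\Sigma(h_2^{-1}(Y_1))\Lambda^{-1}Y_1$. For gains $\varrho,\psi>0$ and a symmetric positive definite matrix $\Gamma$, and with arbitrary initial values, let $$\dot\zeta_1=-\varrho(\zeta_1-Z_1),\quad \dot\zeta_2=-\varrho\zeta_2+Z_2,\quad \dot\varphi=-\varrho\varphi+\phi,\quad \zeta=\zeta_1+\zeta_2,$$ $$\dot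 R=-\psi R+\frac{\varphi\varphi^{\mathrm T}}{1+\|\varphi\|_2^2},\quad \dot Q=-\psi Q-\frac{(Z_1-\zeta)\varphi}{1+\|\varphi\|_2^2},\quad \dot{\hat\theta}=-\Gamma(R\hat\theta+Q),$$ and put $\hat\Theta=\mathrm{diag}(\hat\theta)$, $\tilde\Theta=\Theta-\hat\Theta$. Assume that $\Sigma$, $h_1$, $h_2$ are $C^1$ and that $U\in C^1([0,\infty);\mathbb{R}^{n_U})$ is bounded. Let $(X,z)\in C^1([0,\infty);\mathcal X)\cap C^0([0,\infty);\mathscr D(\mathscr A))$ be a global classical solution of the system with $(X,z)\in L^\infty(\mathbb{R}_{\ge0};\mathcal Y)$. Assume that $(A_1,A_2)$ is detectable, and let $L_1$ be a gain such that $\bar A_1=A_1+L_1A_2$ is Hurwitz. Let $(\tilde X,\tilde z)\in C^1([0,\infty);\mathcal X)\cap C^0([0,\infty);\mathscr D(\mathscr A))$ be a classical solution of the observer error dynamics $$\dot{\tilde X}=\bar A_1\tilde X+G_1\mathscr K_1\tilde z+G_1\hat\Theta\Sigma(v)\mathscr K_2\tilde z+G_1\tilde\Theta\Sigma(v)\mathscr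 K_2z,\qquad \partial_t\tilde z+\Lambda\,\partial_\xi\tilde z=\hat\Theta\Sigma(v)\tilde z+\tilde\Theta\Sigma(v)z,\qquad \tilde z(0,t)=0.$$ Then $(\tilde X,\tilde z)\in L^\infty(\mathbb{R}_{\ge0};\mathcal Y)$. Moreover, if $\varphi$ is persistently exciting, i.e. there are $T_0,\alpha_0>0$ with $\int_t^{t+T_0}\varphi\varphi^{\mathrm T}\,ds\succeq\alpha_0I$ for all $t\ge0$, then $\|(\tilde X(t),\tilde z(\cdot,t))\|_{\mathcal Y}\to0$ exponentially fast, i.e. there are $M,\sigma>0$ with $\|(\tilde X(t),\tilde z(\cdot,t))\|_{\mathcal Y}\le Me^{-\sigma t}$ for all $t\ge0$. -/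

import Mathlib

open MeasureTheory Set
open scoped ContDiff

namespace RollingContact

/-- Test functions on `(0,1)`: smooth, with compact support contained in `(0,1)`. -/
structure IsTestFun (η : ℝ → ℝ) : Prop where
  smooth : ContDiff ℝ ∞ η
  compact : HasCompactSupport η
  supp : tsupport η ⊆ Ioo (0 : ℝ) 1

namespace IsTestFun

theorem exists_Icc {η : ℝ → ℝ} (h : IsTestFun η) :
    ∃ a b : ℝ, 0 < a ∧ a ≤ b ∧ b < 1 ∧ tsupport η ⊆ Icc a b := by
  have hK : IsCompact (tsupport η ∪ {(1 / 2 : ℝ)}) := h.compact.isCompact.union isCompact_singleton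
  have hne : (tsupport η ∪ {(1 / 2 : ℝ)}).Nonempty := ⟨1 / 2, by simp⟩
  have hsub : tsupport η ∪ {(1 / 2 : ℝ)} ⊆ Ioo 0 1 := by
    apply union_subset h.supp
    rintro x rfl
    norm_num
  obtain ⟨a, ha⟩ := hK.exists_isLeast hne
  obtain ⟨b, hb⟩ := hK.exists_isGreatest hne
  exact ⟨a, b, (hsub ha.1).1, ha.2 hb.1, (hsub hb.1).2,
    fun x hx => ⟨ha.2 (Or.inl hx), hb.2 (Or.inl hx)⟩⟩

theorem apply_eq_zero {η : ℝ → ℝ} (h : IsTestFun η) {x : ℝ} (hx : x ∉ Ioo (0 : ℝ) 1) : η x = 0 :=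
  image_eq_zero_of_notMem_tsupport fun hx' => hx (h.supp hx')

theorem exists_primitive {ρ : ℝ → ℝ} (h : IsTestFun ρ) (h0 : ∫ x in (0 : ℝ)..1, ρ x = 0) :
    ∃ χ : ℝ → ℝ, IsTestFun χ ∧ deriv χ = ρ := by
  have hc : Continuous ρ := h.smooth.continuous
  have hd : ∀ x, HasDerivAt (fun x => ∫ t in (0 : ℝ)..x, ρ t) (ρ x) x := fun x =>
    intervalIntegral.integral_hasDerivAt_right (hc.intervalIntegrable _ _)
      hc.stronglyMeasurable.stronglyMeasurableAtFilter hc.continuousAt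
  have hderiv : deriv (fun x => ∫ t in (0 : ℝ)..x, ρ t) = ρ := funext fun x => (hd x).deriv
  obtain ⟨a, b, ha, hab, hb, hs⟩ := h.exists_Icc
  have hz : ∀ x, x ∉ Icc a b → ρ x = 0 := fun x hx =>
    image_eq_zero_of_notMem_tsupport fun hx' => hx (hs hx')
  have hsupp : tsupport (fun x => ∫ t in (0 : ℝ)..x, ρ t) ⊆ Icc a b := by
    apply closure_minimal _ isClosed_Icc
    intro x hx
    by_contra hx'
    apply hx
    rw [mem_Icc, not_and_or, not_le, not_le] at hx'
    rcases hx' with hx' | hx'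
    · show ∫ t in (0 : ℝ)..x, ρ t = 0
      rw [intervalIntegral.integral_congr (g := fun _ => (0 : ℝ))]
      · simp
      · intro t ht
        have : t < a := lt_of_le_of_lt ht.2 (max_lt ha hx')
        exact hz t fun h => absurd h.1 (not_le.2 this)
    · show ∫ t in (0 : ℝ)..x, ρ t = 0
      rw [← intervalIntegral.integral_add_adjacent_intervals (hc.intervalIntegrable 0 1)
        (hc.intervalIntegrable 1 x), h0, zero_add,
        intervalIntegral.integral_congr (g := fun _ => (0 : ℝ))]
      · simp
      · intro t ht
        have : b < t := lt_of_lt_of_le (lt_min hb hx') ht.1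
        exact hz t fun h => absurd h.2 (not_le.2 this)
  refine ⟨_, ⟨?_, ?_, ?_⟩, hderiv⟩
  · rw [contDiff_infty_iff_deriv]
    exact ⟨fun x => (hd x).differentiableAt, by rw [hderiv]; exact h.smooth⟩
  · exact HasCompactSupport.of_support_subset_isCompact isCompact_Icc
      ((subset_tsupport _).trans hsupp)
  · exact hsupp.trans fun x hx => ⟨lt_of_lt_of_le ha hx.1, lt_of_le_of_lt hx.2 hb⟩

theorem sub_mul {η χ : ℝ → ℝ} (h : IsTestFun η) (h' : IsTestFun χ) (c : ℝ) :
    IsTestFun (fun x => η x - c * χ x) where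
  smooth := h.smooth.sub (contDiff_const.mul h'.smooth)
  compact := h.compact.sub (h'.compact.mul_left (f := fun _ => c))
  supp := by
    refine (tsupport_sub _ _).trans (union_subset h.supp (Subset.trans ?_ h'.supp))
    exact tsupport_mul_subset_right (f := fun _ => c)

end IsTestFun

theorem exists_testFun_integral_one :
    ∃ η : ℝ → ℝ, IsTestFun η ∧ ∫ x in (0 : ℝ)..1, η x = 1 := by
  let B : ContDiffBump (1 / 2 : ℝ) := ⟨1 / 8, 1 / 4, by norm_num, by norm_num⟩
  have hT : IsTestFun (B.normed volume) :=
    ⟨B.contDiff_normed, B.hasCompactSupport_normed, by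
      rw [B.tsupport_normed_eq, Real.closedBall_eq_Icc]
      intro x hx
      have h1 : (1 / 2 : ℝ) - 1 / 4 ≤ x := hx.1
      have h2 : x ≤ (1 / 2 : ℝ) + 1 / 4 := hx.2
      constructor <;> linarith⟩
  refine ⟨_, hT, ?_⟩
  rw [intervalIntegral.integral_of_le zero_le_one, setIntegral_eq_integral_of_forall_compl_eq_zero]
  · exact B.integral_normed
  · intro x hx
    exact hT.apply_eq_zero fun h => hx ⟨h.1, h.2.le⟩

/-- An integrable function with an integrable weak derivative is a.e. a primitive of it. -/
theorem exists_const_add_integral {f g : ℝ → ℝ} (hf : IntegrableOn f (Ioo 0 1))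
    (hg : IntegrableOn g (Ioo 0 1))
    (h : ∀ η, IsTestFun η → ∫ x in Ioo (0 : ℝ) 1, deriv η x * f x
      = -∫ x in Ioo (0 : ℝ) 1, η x * g x) :
    ∃ c : ℝ, ∀ᵐ x ∂(volume.restrict (Ioo (0 : ℝ) 1)), f x = c + ∫ t in (0 : ℝ)..x, g t := by
  have e : ∀ F : ℝ → ℝ, ∫ x in Ioo (0 : ℝ) 1, F x = ∫ x in (0 : ℝ)..1, F x := fun F => by
    rw [intervalIntegral.integral_of_le zero_le_one, integral_Ioc_eq_integral_Ioo]
  have ii : ∀ F : ℝ → ℝ, IntegrableOn F (Ioo 0 1) → IntervalIntegrable F volume 0 1 :=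
    fun F hF => by
      rw [intervalIntegrable_iff_integrableOn_Ioo_of_le zero_le_one]; exact hF
  set G : ℝ → ℝ := fun x => ∫ t in (0 : ℝ)..x, g t with hG
  have hGac : AbsolutelyContinuousOnInterval G 0 1 :=
    (ii g hg).absolutelyContinuousOnInterval_intervalIntegral (by simp)
  have hGint : IntervalIntegrable G volume 0 1 := hGac.continuousOn.intervalIntegrable
  have key : ∀ η, IsTestFun η → ∫ x in (0 : ℝ)..1, deriv η x * (f x - G x) = 0 := by
    intro η hη
    have hηac : AbsolutelyContinuousOnInterval η 0 1 :=
      ((hη.smooth.of_le (by simp)).contDiffOn (n := 1)).absolutelyContinuousOnInterval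
    have h1 := hηac.integral_mul_deriv_eq_deriv_mul hGac
    rw [hη.apply_eq_zero (x := 1) (by simp), hη.apply_eq_zero (x := 0) (by simp)] at h1
    have h2 : ∫ x in (0 : ℝ)..1, η x * deriv G x = ∫ x in (0 : ℝ)..1, η x * g x := by
      apply intervalIntegral.integral_congr_ae
      filter_upwards [(ii g hg).ae_hasDerivAt_integral] with x hx hx'
      rw [(hx (uIoc_subset_uIcc hx') 0 (by simp)).deriv]
    have h3 := h η hη
    rw [e, e] at h3
    have hdc : Continuous (deriv η) := (hη.smooth.continuous_deriv (by simp))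
    simp only [mul_sub]
    rw [intervalIntegral.integral_sub ((ii f hf).continuousOn_mul hdc.continuousOn)
      (hGint.continuousOn_mul hdc.continuousOn), h3, ← h2, h1]
    ring
  obtain ⟨η₀, hη₀, hη₁⟩ := exists_testFun_integral_one
  set c : ℝ := ∫ x in (0 : ℝ)..1, η₀ x * (f x - G x) with hc
  have hfG : IntervalIntegrable (fun x => f x - G x) volume 0 1 := (ii f hf).sub hGint
  refine ⟨c, ?_⟩
  have hloc : LocallyIntegrableOn (fun x => f x - G x - c) (Ioo 0 1) volume := by
    apply IntegrableOn.locallyIntegrableOn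
    rw [← intervalIntegrable_iff_integrableOn_Ioo_of_le zero_le_one]
    exact hfG.sub intervalIntegrable_const
  have := isOpen_Ioo.ae_eq_zero_of_integral_contDiff_smul_eq_zero hloc ?_
  · rw [ae_restrict_iff' measurableSet_Ioo]
    filter_upwards [this] with x hx hx'
    have := hx hx'
    linarith
  · intro ψ hψ1 hψ2 hψ3
    have hψ : IsTestFun ψ := ⟨hψ1, hψ2, hψ3⟩
    set m : ℝ := ∫ x in (0 : ℝ)..1, ψ x with hm
    have hψi : IntervalIntegrable ψ volume 0 1 := hψ1.continuous.intervalIntegrable _ _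
    have hη₀i : IntervalIntegrable η₀ volume 0 1 := hη₀.smooth.continuous.intervalIntegrable _ _
    obtain ⟨χ, hχ, hχd⟩ := (hψ.sub_mul hη₀ m).exists_primitive (by
      rw [intervalIntegral.integral_sub hψi (hη₀i.const_mul m),
        intervalIntegral.integral_const_mul, hη₁]
      simp [hm])
    have h4 := key χ hχ
    rw [hχd] at h4
    have h5 : IntervalIntegrable (fun x => ψ x * (f x - G x)) volume 0 1 :=
      hfG.continuousOn_mul hψ1.continuous.continuousOn
    have h6 : IntervalIntegrable (fun x => η₀ x * (f x - G x)) volume 0 1 :=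
      hfG.continuousOn_mul hη₀.smooth.continuous.continuousOn
    have h7 : ∫ x in (0 : ℝ)..1, ψ x * (f x - G x) = m * c := by
      have : (fun x => (ψ x - m * η₀ x) * (f x - G x))
          = fun x => ψ x * (f x - G x) - m * (η₀ x * (f x - G x)) := by
        funext x; ring
      rw [this, intervalIntegral.integral_sub h5 (h6.const_mul m),
        intervalIntegral.integral_const_mul] at h4
      linarith
    rw [← setIntegral_eq_integral_of_forall_compl_eq_zero (s := Ioo 0 1)
      (fun x hx => by simp [hψ.apply_eq_zero hx]), e]
    simp only [smul_eq_mul]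
    have : (fun x => ψ x * (f x - G x - c)) = fun x => ψ x * (f x - G x) - c * ψ x := by
      funext x; ring
    rw [this, intervalIntegral.integral_sub h5 (hψi.const_mul c), h7,
      intervalIntegral.integral_const_mul]
    ring

/-- The Euclidean space `ℝⁿ` with the standard Euclidean norm. -/
abbrev Vec (n : ℕ) : Type := EuclideanSpace ℝ (Fin n)

/-- Lebesgue measure on the open unit interval `(0,1)`. -/
noncomputable abbrev unitMeasure : Measure ℝ := volume.restrict (Ioo (0 : ℝ) 1)

/-- The Hilbert space `L²((0,1); ℝⁿ)`. -/
abbrev L2 (n : ℕ) : Type := Lp (Vec n) 2 unitMeasure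

theorem integrable_L2 {n : ℕ} (f : L2 n) : Integrable f unitMeasure :=
  (Lp.memLp f).integrable (by norm_num)

theorem integrable_smul_L2 {n : ℕ} {η : ℝ → ℝ} (hη : Continuous η) (hc : HasCompactSupport η)
    (f : L2 n) : Integrable (fun ξ => η ξ • f ξ) unitMeasure := by
  obtain ⟨C, hC⟩ := hc.exists_bound_of_continuous hη
  exact (integrable_L2 f).bdd_smul C hη.aestronglyMeasurable (Filter.Eventually.of_forall hC)

/-- `g` is the weak derivative of `f` on `(0,1)`. -/
def IsWeakDeriv {n : ℕ} (f g : L2 n) : Prop :=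
  ∀ η : ℝ → ℝ, IsTestFun η →
    ∫ ξ, deriv η ξ • f ξ ∂unitMeasure = -∫ ξ, η ξ • g ξ ∂unitMeasure

/-- The Hilbert space `H¹((0,1); ℝⁿ)`: the functions `ζ ∈ L²` with a weak derivative in `L²`.
An element is the pair of `ζ` and its weak derivative (which `ζ` determines), so that the norm
inherited from `L² × L²` is the one given by `‖ζ‖² = ‖ζ‖²_{L²} + ‖∂ζ/∂ξ‖²_{L²}`. -/
noncomputable def H1 (n : ℕ) : Submodule ℝ (WithLp 2 (L2 n × L2 n)) where
  carrier := {p | IsWeakDeriv p.fst p.snd}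
  zero_mem' := by
    intro η _
    have h0 : ⇑(0 : L2 n) =ᵐ[unitMeasure] 0 := Lp.coeFn_zero _ _ _
    rw [integral_eq_zero_of_ae, integral_eq_zero_of_ae, neg_zero]
    · filter_upwards [h0] with ξ hξ
      rw [WithLp.zero_snd, hξ, Pi.zero_apply, smul_zero]
    · filter_upwards [h0] with ξ hξ
      rw [WithLp.zero_fst, hξ, Pi.zero_apply, smul_zero]
  add_mem' := by
    intro p q hp hq η hη
    have hd : Continuous (deriv η) := hη.smooth.continuous_deriv (by simp)
    have e1 : ∫ ξ, deriv η ξ • (p + q).fst ξ ∂unitMeasure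
        = ∫ ξ, (deriv η ξ • p.fst ξ + deriv η ξ • q.fst ξ) ∂unitMeasure := by
      apply integral_congr_ae
      filter_upwards [Lp.coeFn_add p.fst q.fst] with ξ hξ
      rw [WithLp.add_fst, hξ, Pi.add_apply, smul_add]
    have e2 : ∫ ξ, η ξ • (p + q).snd ξ ∂unitMeasure
        = ∫ ξ, (η ξ • p.snd ξ + η ξ • q.snd ξ) ∂unitMeasure := by
      apply integral_congr_ae
      filter_upwards [Lp.coeFn_add p.snd q.snd] with ξ hξ
      rw [WithLp.add_snd, hξ, Pi.add_apply, smul_add]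
    rw [e1, e2, integral_add (integrable_smul_L2 hd hη.compact.deriv _)
      (integrable_smul_L2 hd hη.compact.deriv _),
      integral_add (integrable_smul_L2 hη.smooth.continuous hη.compact _)
      (integrable_smul_L2 hη.smooth.continuous hη.compact _), hp η hη, hq η hη, neg_add]
  smul_mem' := by
    intro c p hp η hη
    have e1 : ∫ ξ, deriv η ξ • (c • p).fst ξ ∂unitMeasure
        = ∫ ξ, c • (deriv η ξ • p.fst ξ) ∂unitMeasure := by
      apply integral_congr_ae
      filter_upwards [Lp.coeFn_smul c p.fst] with ξ hξ
      rw [WithLp.smul_fst, hξ, Pi.smul_apply, smul_comm]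
    have e2 : ∫ ξ, η ξ • (c • p).snd ξ ∂unitMeasure
        = ∫ ξ, c • (η ξ • p.snd ξ) ∂unitMeasure := by
      apply integral_congr_ae
      filter_upwards [Lp.coeFn_smul c p.snd] with ξ hξ
      rw [WithLp.smul_snd, hξ, Pi.smul_apply, smul_comm]
    rw [e1, e2, integral_smul, integral_smul, hp η hη, smul_neg]

namespace H1

variable {n : ℕ}

/-- The underlying `L²` function of an `H¹` function. -/
def toL2 (ζ : H1 n) : L2 n := ζ.1.fst

/-- The weak derivative of an `H¹` function. -/
def wderiv (ζ : H1 n) : L2 n := ζ.1.snd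

theorem exists_continuous_rep (ζ : H1 n) :
    ∃ u : ℝ → Vec n, ContinuousOn u (Icc 0 1) ∧ ⇑(toL2 ζ) =ᵐ[unitMeasure] u := by
  have hcomp : ∀ i : Fin n, ∃ c : ℝ, ∀ᵐ x ∂unitMeasure,
      toL2 ζ x i = c + ∫ t in (0 : ℝ)..x, wderiv ζ t i := by
    intro i
    let P : Vec n →L[ℝ] ℝ := EuclideanSpace.proj i
    apply exists_const_add_integral (P.integrable_comp (integrable_L2 _))
      (P.integrable_comp (integrable_L2 _))
    intro η hη
    have hd : Continuous (deriv η) := hη.smooth.continuous_deriv (by simp)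
    have h := congrArg P (ζ.2 η hη)
    rw [map_neg, ← P.integral_comp_comm (integrable_smul_L2 hd hη.compact.deriv _),
      ← P.integral_comp_comm (integrable_smul_L2 hη.smooth.continuous hη.compact _)] at h
    simpa [P, toL2, wderiv] using h
  choose c hc using hcomp
  refine ⟨fun x => WithLp.toLp 2 fun i => c i + ∫ t in (0 : ℝ)..x, wderiv ζ t i, ?_, ?_⟩
  · apply (PiLp.continuous_toLp 2 _).comp_continuousOn
    apply continuousOn_pi.2
    intro i
    have hi : IntegrableOn (fun t => wderiv ζ t i) (uIcc 0 1) volume := by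
      rw [uIcc_of_le zero_le_one, integrableOn_Icc_iff_integrableOn_Ioo]
      exact (EuclideanSpace.proj i : Vec n →L[ℝ] ℝ).integrable_comp (integrable_L2 _)
    have := intervalIntegral.continuousOn_primitive_interval hi
    rw [uIcc_of_le zero_le_one] at this
    exact continuousOn_const.add this
  · filter_upwards [ae_all_iff.2 hc] with x hx
    ext i
    exact hx i

/-- The continuous representative on `[0,1]` of an `H¹` function (unique on `[0,1]`). -/
noncomputable def rep (ζ : H1 n) : ℝ → Vec n := Classical.choose (exists_continuous_rep ζ)

theorem rep_continuousOn (ζ : H1 n) : ContinuousOn (rep ζ) (Icc 0 1) :=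
  (Classical.choose_spec (exists_continuous_rep ζ)).1

theorem toL2_ae_eq_rep (ζ : H1 n) : ⇑(toL2 ζ) =ᵐ[unitMeasure] rep ζ :=
  (Classical.choose_spec (exists_continuous_rep ζ)).2

theorem rep_unique (ζ : H1 n) {u : ℝ → Vec n} (hu : ContinuousOn u (Icc 0 1))
    (h : ⇑(toL2 ζ) =ᵐ[unitMeasure] u) : EqOn (rep ζ) u (Icc 0 1) := by
  apply Measure.eqOn_Icc_of_ae_eq volume zero_ne_one _ (rep_continuousOn ζ) hu
  have h' : rep ζ =ᵐ[volume.restrict (Ioo (0 : ℝ) 1)] u := (toL2_ae_eq_rep ζ).symm.trans h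
  rwa [restrict_Ioo_eq_restrict_Icc] at h'

end H1

/-- Multiplication by an `m × n` matrix, as a continuous linear map `ℝⁿ → ℝᵐ`. -/
noncomputable def mulVecL {m n : ℕ} (M : Matrix (Fin m) (Fin n) ℝ) : Vec n →L[ℝ] Vec m :=
  LinearMap.toContinuousLinearMap (Matrix.toEuclideanLin M)

/-- The Hilbert space `𝒳 = ℝ^{nX} × L²((0,1); ℝ^{nz})`, with `‖(Z, ζ)‖² = ‖Z‖² + ‖ζ‖²`. -/
abbrev SpaceX (nX nz : ℕ) : Type := WithLp 2 (Vec nX × L2 nz)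

/-- The Hilbert space `𝒴 = ℝ^{nX} × H¹((0,1); ℝ^{nz})`, with `‖(Z, ζ)‖² = ‖Z‖² + ‖ζ‖²`. -/
abbrev SpaceY (nX nz : ℕ) : Type := WithLp 2 (Vec nX × H1 nz)

/-- The inclusion of `𝒴` into `𝒳`. -/
def SpaceY.toX {nX nz : ℕ} (p : SpaceY nX nz) : SpaceX nX nz :=
  WithLp.toLp 2 (p.fst, H1.toL2 p.snd)

/-- The domain `𝒟(𝒜) = {(Z, ζ) ∈ 𝒴 | ζ(0) = 0}`. -/
def domA (nX nz : ℕ) : Set (SpaceY nX nz) := {p | H1.rep p.snd 0 = 0}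

/-- The regularity class `C¹([0,∞); 𝒳) ∩ C⁰([0,∞); 𝒟(𝒜))`. -/
structure IsClassicalCurve {nX nz : ℕ} (w : ℝ → SpaceY nX nz) : Prop where
  mem_domA : ∀ t, 0 ≤ t → w t ∈ domA nX nz
  continuousOn : ContinuousOn w (Ici 0)
  contDiffOn : ContDiffOn ℝ 1 (fun t => SpaceY.toX (w t)) (Ici 0)

/-- The data of the semilinear ODE-PDE system: constant matrices, transport velocities `lam`
(`Λ = diag lam`), friction parameters `θ` (`Θ = diag θ`), source matrix `Sig`, nonlinearities `h₁`
and `h₂` (invertible), and the kernels `K₁`, `K₃` and boundary weight `K₂` of the coupling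
operators. -/
structure System (nX nz nU : ℕ) where
  A₁ : Matrix (Fin nX) (Fin nX) ℝ
  A₂ : Matrix (Fin nz) (Fin nX) ℝ
  G₁ : Matrix (Fin nX) (Fin nz) ℝ
  G₂ : Matrix (Fin nz) (Fin nU) ℝ
  lam : Fin nz → ℝ
  lam_pos : ∀ i, 0 < lam i
  θ : Vec nz
  θ_pos : ∀ i, 0 < θ i
  Sig : Vec nz → Matrix (Fin nz) (Fin nz) ℝ
  h₁ : Vec nz → Vec nz
  h₂ : Vec nz ≃ Vec nz
  K₁ : ℝ → Matrix (Fin nz) (Fin nz) ℝ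
  K₂ : Matrix (Fin nz) (Fin nz) ℝ
  K₃ : ℝ → Matrix (Fin nz) (Fin nz) ℝ
  K₁_continuousOn : ContinuousOn K₁ (Icc 0 1)
  K₃_continuousOn : ContinuousOn K₃ (Icc 0 1)

namespace System

variable {nX nz nU : ℕ} (S : System nX nz nU)

/-- `Λ = diag(λ₁, …, λ_{nz})`. -/
def Lam : Matrix (Fin nz) (Fin nz) ℝ := Matrix.diagonal S.lam

/-- `Θ = diag(θ₁, …, θ_{nz})`. -/
def Theta : Matrix (Fin nz) (Fin nz) ℝ := Matrix.diagonal S.θ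

/-- The rigid relative velocity `v(X, U) = A₂ X + G₂ U`. -/
noncomputable def vel (X : Vec nX) (u : Vec nU) : Vec nz := mulVecL S.A₂ X + mulVecL S.G₂ u

/-- `𝒦₁ ζ = ∫₀¹ K₁(ξ) ζ(ξ) dξ + K₂ ζ(1)`. -/
noncomputable def opK₁ (ζ : H1 nz) : Vec nz :=
  (∫ ξ, mulVecL (S.K₁ ξ) (H1.toL2 ζ ξ) ∂unitMeasure) + mulVecL S.K₂ (H1.rep ζ 1)

/-- `𝒦₂ ζ = ∫₀¹ K₃(ξ) ζ(ξ) dξ`. -/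
noncomputable def opK₂ (ζ : L2 nz) : Vec nz := ∫ ξ, mulVecL (S.K₃ ξ) (ζ ξ) ∂unitMeasure

/-- `w = (X, z)` is a classical solution on `[0,∞)` of the ODE-PDE system with input `U`:
`X' = A₁X + G₁𝒦₁z + G₁ΘΣ(v)𝒦₂z + G₁h₁(v)`, `∂z/∂t + Λ ∂z/∂ξ = ΘΣ(v)z + h₂(v)`, `z(0,t) = 0`,
where `v = v(X(t), U(t))` and `t > 0`. -/
structure IsPlantSolution (U : ℝ → Vec nU) (w : ℝ → SpaceY nX nz) : Prop where
  regular : IsClassicalCurve w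
  ode : ∀ t, 0 < t → HasDerivAt (fun s => (w s).fst)
    (mulVecL S.A₁ (w t).fst + mulVecL S.G₁ (S.opK₁ (w t).snd)
      + mulVecL (S.G₁ * S.Theta * S.Sig (S.vel (w t).fst (U t))) (S.opK₂ (H1.toL2 (w t).snd))
      + mulVecL S.G₁ (S.h₁ (S.vel (w t).fst (U t)))) t
  pde : ∀ t, 0 < t → HasDerivAt (fun s => H1.toL2 (w s).snd)
    (-(mulVecL S.Lam).compLp (H1.wderiv (w t).snd)
      + (mulVecL (S.Theta * S.Sig (S.vel (w t).fst (U t)))).compLp (H1.toL2 (w t).snd)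
      + Lp.const 2 unitMeasure (S.h₂ (S.vel (w t).fst (U t)))) t

/-- The first measured signal `Y₁(t) = dz(0,t)/dt = h₂(v(X(t), U(t)))`. -/
noncomputable def meas₁ (U : ℝ → Vec nU) (w : ℝ → SpaceY nX nz) (t : ℝ) : Vec nz :=
  S.h₂ (S.vel (w t).fst (U t))

/-- The second measured signal
`Y₂(t) = d²z(0,t)/dt² = Θ Λ Σ(h₂⁻¹(Y₁(t))) Λ⁻¹ Y₁(t) + Y₁'(t)`. -/
noncomputable def meas₂ (U : ℝ → Vec nU) (w : ℝ → SpaceY nX nz) (t : ℝ) : Vec nz :=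
  mulVecL (S.Theta * S.Lam * S.Sig (S.h₂.symm (S.meas₁ U w t)) * S.Lam⁻¹) (S.meas₁ U w t)
    + deriv (S.meas₁ U w) t

/-- The regressor `ϕ(t) = -Λ Σ(h₂⁻¹(Y₁(t))) Λ⁻¹ Y₁(t)`. -/
noncomputable def regressor (U : ℝ → Vec nU) (w : ℝ → SpaceY nX nz) (t : ℝ) : Vec nz :=
  -mulVecL (S.Lam * S.Sig (S.h₂.symm (S.meas₁ U w t)) * S.Lam⁻¹) (S.meas₁ U w t)

/-- The filters with gain `ϱ`, and the adaptive law with gains `Γ`, `ψ`, for `t > 0` and with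
arbitrary initial values. Here `Z₁ = 1ᵀY₁`, `Z₂ = 1ᵀY₂`, `ζ = ζ₁ + ζ₂`, and
`ζ₁' = -ϱ(ζ₁ - Z₁)`, `ζ₂' = -ϱζ₂ + Z₂`, `φ' = -ϱφ + ϕ`, `R' = -ψR + φφᵀ/(1 + ‖φ‖²)`,
`Q' = -ψQ - (Z₁ - ζ)φ/(1 + ‖φ‖²)`, `θ̂' = -Γ(Rθ̂ + Q)`. -/
structure IsIdentifier (ρ ψ : ℝ) (Γ : Matrix (Fin nz) (Fin nz) ℝ) (U : ℝ → Vec nU)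
    (w : ℝ → SpaceY nX nz) (ζ₁ ζ₂ : ℝ → ℝ) (φ : ℝ → Vec nz) (R : ℝ → Matrix (Fin nz) (Fin nz) ℝ)
    (Q θhat : ℝ → Vec nz) : Prop where
  ζ₁_continuousOn : ContinuousOn ζ₁ (Ici 0)
  ζ₂_continuousOn : ContinuousOn ζ₂ (Ici 0)
  φ_continuousOn : ContinuousOn φ (Ici 0)
  R_continuousOn : ContinuousOn R (Ici 0)
  Q_continuousOn : ContinuousOn Q (Ici 0)
  θhat_continuousOn : ContinuousOn θhat (Ici 0)
  ζ₁_ode : ∀ t, 0 < t → HasDerivAt ζ₁ (-ρ * (ζ₁ t - ∑ i, S.meas₁ U w t i)) t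
  ζ₂_ode : ∀ t, 0 < t → HasDerivAt ζ₂ (-ρ * ζ₂ t + ∑ i, S.meas₂ U w t i) t
  φ_ode : ∀ t, 0 < t → HasDerivAt φ (-ρ • φ t + S.regressor U w t) t
  R_ode : ∀ t, 0 < t → HasDerivAt R
    (-ψ • R t + (1 + ‖φ t‖ ^ 2)⁻¹ • Matrix.vecMulVec (φ t) (φ t)) t
  Q_ode : ∀ t, 0 < t → HasDerivAt Q
    (-ψ • Q t - ((∑ i, S.meas₁ U w t i - (ζ₁ t + ζ₂ t)) / (1 + ‖φ t‖ ^ 2)) • φ t) t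
  θhat_ode : ∀ t, 0 < t → HasDerivAt θhat (-mulVecL Γ (mulVecL (R t) (θhat t) + Q t)) t

/-- `w' = (X̂, ẑ)` is a classical solution on `[0,∞)` of the observer with gain `L₁` and
parameter estimate `θhat` (`Θ̂ = diag θhat`), driven by the measurement `Y₁` of `w`. -/
structure IsObserverSolution (L₁ : Matrix (Fin nX) (Fin nz) ℝ) (U : ℝ → Vec nU)
    (w : ℝ → SpaceY nX nz) (θhat : ℝ → Vec nz) (w' : ℝ → SpaceY nX nz) : Prop where
  regular : IsClassicalCurve w'
  ode : ∀ t, 0 < t → HasDerivAt (fun s => (w' s).fst)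
    (mulVecL S.A₁ (w' t).fst + mulVecL S.G₁ (S.opK₁ (w' t).snd)
      + mulVecL (S.G₁ * Matrix.diagonal (θhat t) * S.Sig (S.h₂.symm (S.meas₁ U w t)))
          (S.opK₂ (H1.toL2 (w' t).snd))
      + mulVecL S.G₁ (S.h₁ (S.h₂.symm (S.meas₁ U w t)))
      - mulVecL L₁ (S.h₂.symm (S.meas₁ U w t) - S.h₂.symm (S.meas₁ U w' t))) t
  pde : ∀ t, 0 < t → HasDerivAt (fun s => H1.toL2 (w' s).snd)
    (-(mulVecL S.Lam).compLp (H1.wderiv (w' t).snd)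
      + (mulVecL (Matrix.diagonal (θhat t) * S.Sig (S.h₂.symm (S.meas₁ U w t)))).compLp
          (H1.toL2 (w' t).snd)
      + Lp.const 2 unitMeasure (S.meas₁ U w t)) t

/-- `e = (X̃, z̃)` is a classical solution on `[0,∞)` of the observer error dynamics with gain
`L₁`, parameter estimate `θhat` and parameter error `θ - θhat`, along the trajectory `w = (X, z)`:
`X̃' = (A₁ + L₁A₂)X̃ + G₁𝒦₁z̃ + F₁(t)𝒦₂z̃ + f₁(t)`, `∂z̃/∂t + Λ ∂z̃/∂ξ = F₂(t)z̃ + f₂(ξ,t)`,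
`z̃(0,t) = 0`, with `F₁ = G₁Θ̂Σ(v)`, `F₂ = Θ̂Σ(v)`, `f₁ = G₁Θ̃Σ(v)𝒦₂z`, `f₂ = Θ̃Σ(v)z`. -/
structure IsErrorSolution (L₁ : Matrix (Fin nX) (Fin nz) ℝ) (U : ℝ → Vec nU)
    (w : ℝ → SpaceY nX nz) (θhat : ℝ → Vec nz) (e : ℝ → SpaceY nX nz) : Prop where
  regular : IsClassicalCurve e
  ode : ∀ t, 0 < t → HasDerivAt (fun s => (e s).fst)
    (mulVecL (S.A₁ + L₁ * S.A₂) (e t).fst + mulVecL S.G₁ (S.opK₁ (e t).snd)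
      + mulVecL (S.G₁ * Matrix.diagonal (θhat t) * S.Sig (S.vel (w t).fst (U t)))
          (S.opK₂ (H1.toL2 (e t).snd))
      + mulVecL (S.G₁ * Matrix.diagonal (S.θ - θhat t) * S.Sig (S.vel (w t).fst (U t)))
          (S.opK₂ (H1.toL2 (w t).snd))) t
  pde : ∀ t, 0 < t → HasDerivAt (fun s => H1.toL2 (e s).snd)
    (-(mulVecL S.Lam).compLp (H1.wderiv (e t).snd)
      + (mulVecL (Matrix.diagonal (θhat t) * S.Sig (S.vel (w t).fst (U t)))).compLp
          (H1.toL2 (e t).snd)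
      + (mulVecL (Matrix.diagonal (S.θ - θhat t) * S.Sig (S.vel (w t).fst (U t)))).compLp
          (H1.toL2 (w t).snd)) t

end System

/-- A real square matrix is Hurwitz if all its complex eigenvalues have negative real part. -/
def IsHurwitz {n : ℕ} (A : Matrix (Fin n) (Fin n) ℝ) : Prop :=
  ∀ μ ∈ spectrum ℂ (A.map (algebraMap ℝ ℂ)), μ.re < 0

/-- The pair `(A, C)` is detectable: some output injection makes `A + L C` Hurwitz. -/
def IsDetectable {n m : ℕ} (A : Matrix (Fin n) (Fin n) ℝ) (C : Matrix (Fin m) (Fin n) ℝ) : Prop :=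
  ∃ L : Matrix (Fin n) (Fin m) ℝ, IsHurwitz (A + L * C)

/-- A signal `φ` on `[0,∞)` is persistently exciting if there are `T₀, α₀ > 0` with
`∫_t^{t+T₀} φ(s)φ(s)ᵀ ds ⪰ α₀ I` for every `t ≥ 0`. -/
def PersistentlyExciting {n : ℕ} (φ : ℝ → Vec n) : Prop :=
  ∃ T₀ > (0 : ℝ), ∃ α₀ > (0 : ℝ), ∀ t, 0 ≤ t → ∀ y : Vec n,
    α₀ * ‖y‖ ^ 2 ≤ ∫ s in t..(t + T₀), (inner ℝ (φ s) y) ^ 2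

/-- `f` is bounded on `[0,∞)`. -/
def BoundedOnHalfLine {F : Type*} [Norm F] (f : ℝ → F) : Prop := ∃ C : ℝ, ∀ t, 0 ≤ t → ‖f t‖ ≤ C

section ObserverError

theorem H1.rep_sub {n : ℕ} (ζ ζ' : H1 n) {ξ : ℝ} (hξ : ξ ∈ Icc (0 : ℝ) 1) :
    H1.rep (ζ - ζ') ξ = H1.rep ζ ξ - H1.rep ζ' ξ := by
  refine H1.rep_unique (ζ - ζ') ((H1.rep_continuousOn ζ).sub (H1.rep_continuousOn ζ')) ?_ hξ
  have h : H1.toL2 (ζ - ζ') = H1.toL2 ζ - H1.toL2 ζ' := rfl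
  rw [h]
  filter_upwards [Lp.coeFn_sub (H1.toL2 ζ) (H1.toL2 ζ'), H1.toL2_ae_eq_rep ζ,
    H1.toL2_ae_eq_rep ζ'] with x h1 h2 h3
  rw [h1, Pi.sub_apply, h2, h3]; rfl

theorem IsClassicalCurve.sub {nX nz : ℕ} {w w' : ℝ → SpaceY nX nz} (h : IsClassicalCurve w)
    (h' : IsClassicalCurve w') : IsClassicalCurve (w - w') where
  mem_domA := fun t ht => by
    show H1.rep ((w t).snd - (w' t).snd) 0 = 0
    have h1 : H1.rep (w t).snd 0 = 0 := h.mem_domA t ht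
    have h2 : H1.rep (w' t).snd 0 = 0 := h'.mem_domA t ht
    rw [H1.rep_sub _ _ (by simp), h1, h2, sub_zero]
  continuousOn := h.continuousOn.sub h'.continuousOn
  contDiffOn := h.contDiffOn.sub h'.contDiffOn

theorem integrable_kernel {n : ℕ} {K : ℝ → Matrix (Fin n) (Fin n) ℝ}
    (hK : ContinuousOn K (Icc 0 1)) (ζ : L2 n) :
    Integrable (fun ξ => mulVecL (K ξ) (ζ ξ)) unitMeasure := by
  let T : Matrix (Fin n) (Fin n) ℝ →ₗ[ℝ] (Vec n →L[ℝ] Vec n) :=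
    (LinearMap.toContinuousLinearMap : (Vec n →ₗ[ℝ] Vec n) ≃ₗ[ℝ] _).toLinearMap ∘ₗ
      (Matrix.toEuclideanLin : Matrix (Fin n) (Fin n) ℝ ≃ₗ[ℝ] _).toLinearMap
  have hT : ContinuousOn (fun ξ => mulVecL (K ξ)) (Icc 0 1) :=
    T.continuous_of_finiteDimensional.comp_continuousOn hK
  obtain ⟨C, hC⟩ := isCompact_Icc.exists_bound_of_continuousOn hT
  have hm : AEStronglyMeasurable (fun ξ => mulVecL (K ξ)) unitMeasure :=
    (hT.mono Ioo_subset_Icc_self).aestronglyMeasurable measurableSet_Ioo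
  refine ((integrable_L2 ζ).norm.const_mul C).mono' 
    ((ContinuousLinearMap.id ℝ (Vec n →L[ℝ] Vec n)).aestronglyMeasurable_comp₂ hm
      (integrable_L2 ζ).1) ?_
  filter_upwards [ae_restrict_mem measurableSet_Ioo] with ξ hξ
  exact (ContinuousLinearMap.le_opNorm _ _).trans
    (mul_le_mul_of_nonneg_right (hC ξ (Ioo_subset_Icc_self hξ)) (norm_nonneg _))

theorem integral_kernel_sub {n : ℕ} {K : ℝ → Matrix (Fin n) (Fin n) ℝ}
    (hK : ContinuousOn K (Icc 0 1)) (ζ ζ' : L2 n) :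
    ∫ ξ, mulVecL (K ξ) ((ζ - ζ' : L2 n) ξ) ∂unitMeasure
      = (∫ ξ, mulVecL (K ξ) (ζ ξ) ∂unitMeasure) - ∫ ξ, mulVecL (K ξ) (ζ' ξ) ∂unitMeasure := by
  rw [← integral_sub (integrable_kernel hK ζ) (integrable_kernel hK ζ')]
  apply integral_congr_ae
  filter_upwards [Lp.coeFn_sub ζ ζ'] with ξ hξ
  rw [hξ, Pi.sub_apply, map_sub]

theorem mulVecL_add {m n : ℕ} (M N : Matrix (Fin m) (Fin n) ℝ) :
    mulVecL (M + N) = mulVecL M + mulVecL N := by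
  simp [mulVecL]

theorem mulVecL_mul {m n k : ℕ} (M : Matrix (Fin m) (Fin n) ℝ) (N : Matrix (Fin n) (Fin k) ℝ)
    (x : Vec k) : mulVecL (M * N) x = mulVecL M (mulVecL N x) := by
  ext i
  simp [mulVecL]

theorem compLp_sub {n : ℕ} (L : Vec n →L[ℝ] Vec n) (f g : L2 n) :
    L.compLp (f - g) = L.compLp f - L.compLp g :=
  map_sub (L.compLpL 2 unitMeasure) f g

/-- The difference between a solution of the system and a solution of the observer is a solution
of the observer error dynamics. -/
theorem System.IsObserverSolution.isErrorSolution {nX nz nU : ℕ} {S : System nX nz nU}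
    {L₁ : Matrix (Fin nX) (Fin nz) ℝ} {U : ℝ → Vec nU} {w w' : ℝ → SpaceY nX nz}
    {θhat : ℝ → Vec nz} (hw : S.IsPlantSolution U w) (hw' : S.IsObserverSolution L₁ U w θhat w') :
    S.IsErrorSolution L₁ U w θhat (w - w') where
  regular := hw.regular.sub hw'.regular
  ode := fun t ht => by
    refine ((hw.ode t ht).sub (hw'.ode t ht)).congr_deriv ?_
    have hΘ : S.Theta = Matrix.diagonal (θhat t) + Matrix.diagonal (S.θ - θhat t) := by
      rw [Matrix.diagonal_add]
      simp [System.Theta]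
    have e1 : ((w - w') t).fst = (w t).fst - (w' t).fst := rfl
    have e2 : ((w - w') t).snd = (w t).snd - (w' t).snd := rfl
    have e3 : H1.toL2 ((w t).snd - (w' t).snd) = H1.toL2 (w t).snd - H1.toL2 (w' t).snd := rfl
    have k1 : S.opK₁ ((w t).snd - (w' t).snd) = S.opK₁ (w t).snd - S.opK₁ (w' t).snd := by
      simp only [System.opK₁]
      rw [e3, integral_kernel_sub S.K₁_continuousOn, H1.rep_sub _ _ (by simp), map_sub]
      abel
    have k2 : S.opK₂ (H1.toL2 (w t).snd - H1.toL2 (w' t).snd)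
        = S.opK₂ (H1.toL2 (w t).snd) - S.opK₂ (H1.toL2 (w' t).snd) :=
      integral_kernel_sub S.K₃_continuousOn _ _
    rw [e1, e2, e3, k1, k2, hΘ]
    simp only [System.meas₁, Equiv.symm_apply_apply, System.vel, mulVecL_add, mulVecL_mul,
      map_sub, map_add, add_apply]
    abel
  pde := fun t ht => by
    refine ((hw.pde t ht).sub (hw'.pde t ht)).congr_deriv ?_
    have hΘ : S.Theta = Matrix.diagonal (θhat t) + Matrix.diagonal (S.θ - θhat t) := by
      rw [Matrix.diagonal_add]
      simp [System.Theta]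
    have e2 : ((w - w') t).snd = (w t).snd - (w' t).snd := rfl
    have e3 : H1.toL2 ((w t).snd - (w' t).snd) = H1.toL2 (w t).snd - H1.toL2 (w' t).snd := rfl
    have e4 : H1.wderiv ((w t).snd - (w' t).snd)
        = H1.wderiv (w t).snd - H1.wderiv (w' t).snd := rfl
    rw [e2, e3, e4, hΘ]
    simp only [System.meas₁, Equiv.symm_apply_apply, mulVecL_add, add_mul,
      ContinuousLinearMap.add_compLp, compLp_sub]
    abel

end ObserverError

end RollingContact

/-! The error system is a cascade. The parameter error `θ - θhat` does not depend on the observer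
error, and it forces the latter linearly, through Θ̃Σ(v)z with z and v bounded. Both claims then
come from one estimate in terms of `ExpBounded c`: every small enough rate c ≥ 0 of the parameter
error passes to the observer error, c = 0 giving boundedness and c > 0 decay.

Parameter error (`gradient_estimator_error`, `IsIdentifier.parameter_error`). As Θ is diagonal, Z₂ =
Z₁' - ⟨θ, ϕ⟩, so the filters make Z₁ - ζ - ⟨θ, φ⟩ decay like exp(-ρt). Hence q = Rθ + Q decays, and
the parameter error x obeys x' = Γ(q - Rx). Use the Lyapunov function ⟨x, Γ⁻¹x⟩: R is nonnegative up
to a term of order exp(-ψt), which gives boundedness, and under persistent excitation R is uniformly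
positive up to such a term after one excitation window, which gives decay.

Transport part (`expBounded_of_transport`). The condition z̃(0) = 0 says z̃ = Vy, where V is the
Volterra operator and y = ∂z̃/∂ξ. The coefficients do not depend on ξ, so they commute with V, and
formally y solves the same transport equation with source Θ̃Σ(v)∂z/∂ξ. The weight exp(-kξ) makes
transport as dissipative as desired, enough to beat the bounded coefficient Θ̂Σ(v). Since y need not
be differentiable in time, the energy estimate is made for (ε + V)⁻¹z̃ instead, with constants
independent of ε, and ε is then removed by `norm_le_of_resolvent`. The bound on y also controls z̃
and the trace z̃(1).

ODE part (`IsHurwitz.exists_expBounded`). X̃ solves a Hurwitz linear system whose forcing now has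
the required rate; the bound follows by peeling off the linear factors of the characteristic
polynomial. -/

namespace RollingContact

/-! ### Exponentially weighted bounds on the half line -/

/-- `‖f t‖ ≤ C * exp (-c * t)` on `[0,∞)` for some constant `C`. For `c = 0` this is boundedness. -/
def ExpBounded {F : Type*} [Norm F] (c : ℝ) (f : ℝ → F) : Prop :=
  ∃ C : ℝ, ∀ t, 0 ≤ t → ‖f t‖ ≤ C * Real.exp (-c * t)

theorem expBounded_zero_iff {F : Type*} [Norm F] {f : ℝ → F} :
    ExpBounded 0 f ↔ BoundedOnHalfLine f := by
  simp [ExpBounded, BoundedOnHalfLine]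

namespace ExpBounded

variable {F G H : Type*} [NormedAddCommGroup F] [NormedAddCommGroup G] [NormedAddCommGroup H]
  {c : ℝ} {f : ℝ → F} {g : ℝ → G}

theorem exists_nonneg (hf : ExpBounded c f) :
    ∃ C : ℝ, 0 ≤ C ∧ ∀ t, 0 ≤ t → ‖f t‖ ≤ C * Real.exp (-c * t) := by
  obtain ⟨C, hC⟩ := hf
  refine ⟨|C|, abs_nonneg _, fun t ht => (hC t ht).trans ?_⟩
  gcongr
  exact le_abs_self C

theorem of_le_mul {K : ℝ} (hf : ExpBounded c f) (hK : 0 ≤ K)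
    (h : ∀ t, 0 ≤ t → ‖g t‖ ≤ K * ‖f t‖) : ExpBounded c g := by
  obtain ⟨C, hC⟩ := hf
  refine ⟨K * C, fun t ht => (h t ht).trans ?_⟩
  rw [mul_assoc]
  exact mul_le_mul_of_nonneg_left (hC t ht) hK

theorem of_le_bounded_mul {h : ℝ → H} (hf : ExpBounded c f) (hg : BoundedOnHalfLine g)
    (hh : ∀ t, 0 ≤ t → ‖h t‖ ≤ ‖g t‖ * ‖f t‖) : ExpBounded c h := by
  obtain ⟨K, hK⟩ := hg
  refine hf.of_le_mul (abs_nonneg K) fun t ht => (hh t ht).trans ?_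
  gcongr
  exact (hK t ht).trans (le_abs_self K)

theorem add {f' : ℝ → F} (hf : ExpBounded c f) (hf' : ExpBounded c f') :
    ExpBounded c (fun t => f t + f' t) := by
  obtain ⟨C, hC⟩ := hf
  obtain ⟨C', hC'⟩ := hf'
  refine ⟨C + C', fun t ht => (norm_add_le _ _).trans ?_⟩
  rw [add_mul]
  exact add_le_add (hC t ht) (hC' t ht)

theorem clm_apply {F G : Type*} [NormedAddCommGroup F] [NormedAddCommGroup G]
    [NormedSpace ℝ F] [NormedSpace ℝ G] {f : ℝ → F} (hf : ExpBounded c f)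
    (L : F →L[ℝ] G) : ExpBounded c (fun t => L (f t)) :=
  hf.of_le_mul (norm_nonneg L) fun t _ => L.le_opNorm (f t)

theorem mono {c' : ℝ} (hf : ExpBounded c f) (h : c' ≤ c) : ExpBounded c' f := by
  obtain ⟨C, hC0, hC⟩ := hf.exists_nonneg
  refine ⟨C, fun t ht => (hC t ht).trans ?_⟩
  gcongr

end ExpBounded

/-! ### Differential inequalities -/

theorem monotoneOn_Ici_of_hasDerivAt_nonneg {u u' : ℝ → ℝ} {s : ℝ} (hu : ContinuousOn u (Ici s))
    (hd : ∀ t, s < t → HasDerivAt u (u' t) t) (h : ∀ t, s < t → 0 ≤ u' t) :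
    MonotoneOn u (Ici s) := by
  apply monotoneOn_of_deriv_nonneg (convex_Ici s) hu
  · rw [interior_Ici]
    exact fun t ht => (hd t ht).differentiableAt.differentiableWithinAt
  · rw [interior_Ici]
    intro t ht
    rw [(hd t ht).deriv]
    exact h t ht

theorem hasDerivAt_exp_mul (a t : ℝ) :
    HasDerivAt (fun s => Real.exp (a * s)) (a * Real.exp (a * t)) t := by
  have := ((hasDerivAt_id t).const_mul a).exp
  simpa [mul_comm] using this

/-- Grönwall's inequality with exponential forcing. -/
theorem le_exp_of_deriv_le {u u' : ℝ → ℝ} {a b c : ℝ} (hca : c < a) (hb : 0 ≤ b)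
    (hu : ContinuousOn u (Ici 0)) (hd : ∀ t, 0 < t → HasDerivAt u (u' t) t)
    (h : ∀ t, 0 < t → u' t ≤ -a * u t + b * Real.exp (-c * t)) (hu0 : 0 ≤ u 0) :
    ∀ t, 0 ≤ t → u t ≤ (u 0 + b / (a - c)) * Real.exp (-c * t) := by
  intro t ht
  have hac : 0 < a - c := sub_pos.2 hca
  -- With integrating factor exp(as), the inequality says that exp(as)u(s) grows no faster than the
  -- primitive of b·exp((a - c)s).
  have hmono := monotoneOn_Ici_of_hasDerivAt_nonneg (s := 0)
    (u := fun s => b / (a - c) * Real.exp ((a - c) * s) - Real.exp (a * s) * u s)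
    (u' := fun s => b / (a - c) * ((a - c) * Real.exp ((a - c) * s))
      - (a * Real.exp (a * s) * u s + Real.exp (a * s) * u' s))
    (by
      apply ContinuousOn.sub
      · fun_prop
      · exact ContinuousOn.mul (by fun_prop) hu)
    (fun s hs => ((hasDerivAt_exp_mul _ s).const_mul _).sub
      ((hasDerivAt_exp_mul a s).mul (hd s hs)))
    (fun s hs => by
      have e1 : Real.exp ((a - c) * s) = Real.exp (a * s) * Real.exp (-c * s) := by
        rw [← Real.exp_add]; ring_nf
      have e2 : b / (a - c) * ((a - c) * Real.exp ((a - c) * s))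
          = Real.exp (a * s) * (b * Real.exp (-c * s)) := by
        rw [e1]; field_simp
      rw [e2]
      have := mul_le_mul_of_nonneg_left (h s hs) (Real.exp_pos (a * s)).le
      linarith)
  have h0 := hmono (self_mem_Ici) (mem_Ici.2 ht) ht
  simp only [mul_zero, Real.exp_zero, mul_one, one_mul] at h0
  have e1 : Real.exp ((a - c) * t) = Real.exp (a * t) * Real.exp (-c * t) := by
    rw [← Real.exp_add]; ring_nf
  have e2 : 1 ≤ Real.exp ((a - c) * t) := Real.one_le_exp (by positivity)
  have h1 : Real.exp (a * t) * u t
      ≤ Real.exp (a * t) * ((u 0 + b / (a - c)) * Real.exp (-c * t)) := by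
    have e3 : Real.exp (a * t) * ((u 0 + b / (a - c)) * Real.exp (-c * t))
        = (u 0 + b / (a - c)) * Real.exp ((a - c) * t) := by rw [e1]; ring
    rw [e3, add_mul]
    have : 0 ≤ b / (a - c) := by positivity
    nlinarith
  exact le_of_mul_le_mul_left h1 (Real.exp_pos _)

section Inner

variable {H : Type*} [NormedAddCommGroup H] [InnerProductSpace ℝ H]

/-- Grönwall for ‖x‖²: Young's inequality absorbs the forcing at the cost of a - c, half of the gap
between the damping rate 2a and 2c, leaving a + c > 2c. The constant is kept explicit because the
transport estimate needs it independent of a regularization. -/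
theorem norm_le_of_inner_deriv_le {x x' : ℝ → H} {a c C : ℝ} (hca : c < a)
    (hx : ContinuousOn x (Ici 0)) (hd : ∀ t, 0 < t → HasDerivAt x (x' t) t)
    (h : ∀ t, 0 < t → inner ℝ (x t) (x' t) ≤ -a * ‖x t‖ ^ 2 + C * Real.exp (-c * t) * ‖x t‖) :
    ∀ t, 0 ≤ t → ‖x t‖ ≤ Real.sqrt (‖x 0‖ ^ 2 + (C / (a - c)) ^ 2) * Real.exp (-c * t) := by
  intro t ht
  have hac : 0 < a - c := sub_pos.2 hca
  have key := le_exp_of_deriv_le (u := fun t => ‖x t‖ ^ 2) (a := a + c) (b := C ^ 2 / (a - c))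
    (c := 2 * c) (by linarith) (by positivity) (hx.norm.pow 2) (fun t ht => (hd t ht).norm_sq)
    (fun t ht => by
      have h1 := h t ht
      have e : Real.exp (-(2 * c) * t) = Real.exp (-c * t) ^ 2 := by
        rw [← Real.exp_nat_mul]; push_cast; ring_nf
      rw [e]
      have h2 : 2 * (C * Real.exp (-c * t) * ‖x t‖)
          ≤ (a - c) * ‖x t‖ ^ 2 + C ^ 2 / (a - c) * Real.exp (-c * t) ^ 2 := by
        have h3 := sq_nonneg ((a - c) * ‖x t‖ - C * Real.exp (-c * t))
        have h4 : (a - c) * (2 * (C * Real.exp (-c * t) * ‖x t‖))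
          ≤ (a - c) * ((a - c) * ‖x t‖ ^ 2 + C ^ 2 / (a - c) * Real.exp (-c * t) ^ 2) := by
          have : (a - c) * (C ^ 2 / (a - c) * Real.exp (-c * t) ^ 2)
              = C ^ 2 * Real.exp (-c * t) ^ 2 := by field_simp
          rw [mul_add, this]
          nlinarith
        exact le_of_mul_le_mul_left h4 hac
      linarith) (by positivity) t ht
  have e : Real.exp (-(2 * c) * t) = Real.exp (-c * t) ^ 2 := by
    rw [← Real.exp_nat_mul]; push_cast; ring_nf
  have e2 : C ^ 2 / (a - c) / (a + c - 2 * c) = (C / (a - c)) ^ 2 := by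
    have : a + c - 2 * c = a - c := by ring
    rw [this, div_pow, div_div]; ring
  rw [e, e2] at key
  refine le_of_sq_le_sq ?_ (by positivity)
  rw [mul_pow, Real.sq_sqrt (by positivity)]
  exact key

theorem expBounded_of_inner_deriv_le {x x' : ℝ → H} {a c C : ℝ} (hca : c < a)
    (hx : ContinuousOn x (Ici 0)) (hd : ∀ t, 0 < t → HasDerivAt x (x' t) t)
    (h : ∀ t, 0 < t → inner ℝ (x t) (x' t) ≤ -a * ‖x t‖ ^ 2 + C * Real.exp (-c * t) * ‖x t‖) :
    ExpBounded c x :=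
  ⟨_, norm_le_of_inner_deriv_le hca hx hd h⟩

theorem expBounded_of_hasDerivAt_neg_smul_add {x g : ℝ → H} {a c : ℝ} (hca : c < a)
    (hx : ContinuousOn x (Ici 0)) (hd : ∀ t, 0 < t → HasDerivAt x (-a • x t + g t) t)
    (hg : ExpBounded c g) : ExpBounded c x := by
  obtain ⟨C, hC⟩ := hg
  refine expBounded_of_inner_deriv_le hca hx hd (C := C) fun t ht => ?_
  rw [inner_add_right, inner_smul_right, real_inner_self_eq_norm_sq]
  have h1 := real_inner_le_norm (x t) (g t)
  have h2 := mul_le_mul_of_nonneg_left (hC t ht.le) (norm_nonneg (x t))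
  linarith

/-- If the growth rate of `‖x‖² + 1` is exponentially decaying, then `x` is bounded. -/
theorem bounded_of_inner_deriv_le {x x' : ℝ → H} {a C : ℝ} (ha : 0 < a)
    (hx : ContinuousOn x (Ici 0)) (hd : ∀ t, 0 < t → HasDerivAt x (x' t) t)
    (h : ∀ t, 0 < t → inner ℝ (x t) (x' t) ≤ C * Real.exp (-a * t) * (‖x t‖ ^ 2 + 1)) :
    BoundedOnHalfLine x := by
  -- The exponential is the integrating factor for the integrable growth rate 2C·exp(-at); its
  -- logarithm stays within 2|C|/a of zero. The minus sign turns a decreasing function into an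
  -- increasing one.
  let u : ℝ → ℝ := fun t => -((‖x t‖ ^ 2 + 1) * Real.exp (2 * C / a * Real.exp (-a * t)))
  have hmono : MonotoneOn u (Ici 0) := by
    refine monotoneOn_Ici_of_hasDerivAt_nonneg (s := 0) (u' := fun t =>
        -(2 * inner ℝ (x t) (x' t) * Real.exp (2 * C / a * Real.exp (-a * t)) + (‖x t‖ ^ 2 + 1) *
          (Real.exp (2 * C / a * Real.exp (-a * t)) * (2 * C / a * (-a * Real.exp (-a * t))))))
        ?_ ?_ ?_
    · apply ContinuousOn.neg
      apply ContinuousOn.mul ((hx.norm.pow 2).add continuousOn_const)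
      fun_prop
    · intro t ht
      exact (((hd t ht).norm_sq.add_const 1).mul
        (((hasDerivAt_exp_mul (-a) t).const_mul (2 * C / a)).exp)).neg
    · intro t ht
      have e : 2 * C / a * (-a * Real.exp (-a * t)) = -(2 * C * Real.exp (-a * t)) := by
        field_simp
      rw [e]
      have := mul_le_mul_of_nonneg_right (h t ht)
        (Real.exp_pos (2 * C / a * Real.exp (-a * t))).le
      linarith
  refine ⟨Real.sqrt ((‖x 0‖ ^ 2 + 1) * Real.exp (2 * C / a) * Real.exp (2 * |C| / a)),
    fun t ht => Real.le_sqrt_of_sq_le ?_⟩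
  have h0 := hmono self_mem_Ici (mem_Ici.2 ht) ht
  simp only [u, mul_zero, Real.exp_zero, mul_one, neg_le_neg_iff] at h0
  have h1 : 1 ≤ Real.exp (2 * C / a * Real.exp (-a * t)) * Real.exp (2 * |C| / a) := by
    rw [← Real.exp_add]
    apply Real.one_le_exp
    have h2 : Real.exp (-a * t) ≤ 1 := Real.exp_le_one_iff.2 (by nlinarith)
    have h3 : -(|C| * 1) ≤ C * Real.exp (-a * t) := by
      have : |C * Real.exp (-a * t)| ≤ |C| * 1 := by
        rw [abs_mul, abs_of_pos (Real.exp_pos _)]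
        exact mul_le_mul_of_nonneg_left h2 (abs_nonneg C)
      exact (abs_le.1 this).1
    have : 2 * C / a * Real.exp (-a * t) + 2 * |C| / a
        = 2 * (C * Real.exp (-a * t) + |C|) / a := by ring
    rw [this]
    apply div_nonneg _ ha.le
    linarith
  calc ‖x t‖ ^ 2 ≤ (‖x t‖ ^ 2 + 1) * 1 := by linarith
    _ ≤ (‖x t‖ ^ 2 + 1) *
        (Real.exp (2 * C / a * Real.exp (-a * t)) * Real.exp (2 * |C| / a)) := by gcongr
    _ = (‖x t‖ ^ 2 + 1) * Real.exp (2 * C / a * Real.exp (-a * t)) * Real.exp (2 * |C| / a) := by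
        ring
    _ ≤ _ := by gcongr

end Inner

/-! ### Linear systems with a Hurwitz matrix -/

section Hurwitz

open Polynomial

theorem expBounded_of_hasDerivAt_mul_add {x g : ℝ → ℂ} {μ : ℂ} {c : ℝ} (hc : c < -μ.re)
    (hx : ContinuousOn x (Ici 0)) (hd : ∀ t, 0 < t → HasDerivAt x (μ * x t + g t) t)
    (hg : ExpBounded c g) : ExpBounded c x := by
  obtain ⟨C, hC⟩ := hg
  refine expBounded_of_inner_deriv_le hc hx hd (C := C) fun t ht => ?_
  rw [inner_add_right]
  have h0 : inner ℝ (x t) (μ * x t) = μ.re * ‖x t‖ ^ 2 := by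
    rw [Complex.inner, Complex.sq_norm, Complex.normSq_apply]
    simp
    ring
  have h1 := real_inner_le_norm (x t) (g t)
  have h2 := mul_le_mul_of_nonneg_left (hC t ht.le) (norm_nonneg (x t))
  rw [h0]
  linarith

theorem expBounded_pi_iff {n : ℕ} {c : ℝ} {x : ℝ → Fin n → ℂ} :
    ExpBounded c x ↔ ∀ i, ExpBounded c (fun t => x t i) := by
  constructor
  · rintro ⟨C, hC⟩ i
    exact ⟨C, fun t ht => (norm_le_pi_norm (x t) i).trans (hC t ht)⟩
  · intro h
    choose C hC using fun i => (h i).exists_nonneg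
    refine ⟨∑ i, C i, fun t ht => ?_⟩
    rw [pi_norm_le_iff_of_nonneg
      (mul_nonneg (Finset.sum_nonneg fun i _ => (hC i).1) (Real.exp_pos _).le)]
    intro i
    refine ((hC i).2 t ht).trans ?_
    gcongr
    exact Finset.single_le_sum (f := C) (fun i _ => (hC i).1) (Finset.mem_univ i)

theorem expBounded_mulVec {n : ℕ} {c : ℝ} {x : ℝ → Fin n → ℂ} (hx : ExpBounded c x)
    (M : Matrix (Fin n) (Fin n) ℂ) : ExpBounded c (fun t => M.mulVec (x t)) :=
  hx.clm_apply ((LinearMap.toContinuousLinearMap (Matrix.mulVecLin M)).restrictScalars ℝ)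

theorem hasDerivAt_mulVec {n : ℕ} {x : ℝ → Fin n → ℂ} {x' : Fin n → ℂ} {t : ℝ}
    (hx : HasDerivAt x x' t) (M : Matrix (Fin n) (Fin n) ℂ) :
    HasDerivAt (fun t => M.mulVec (x t)) (M.mulVec x') t :=
  ((LinearMap.toContinuousLinearMap (Matrix.mulVecLin M)).restrictScalars ℝ).hasFDerivAt
    |>.comp_hasDerivAt t hx

/-- Peel off one root μ at a time, with no matrix exponential or Jordan form. If B = A - μ, then y =
Bx solves the same equation with forcing Bf, since A and B commute, so induction bounds y. Then x' =
μx + (y + f) decouples into scalar equations. -/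
theorem exists_expBounded_of_aeval_prod {n : ℕ} (A : Matrix (Fin n) (Fin n) ℂ) (s : Multiset ℂ) :
    (∀ μ ∈ s, μ.re < 0) → ∃ c₀ > (0 : ℝ), ∀ c ≤ c₀, ∀ x f : ℝ → Fin n → ℂ,
      ContinuousOn x (Ici 0) → (∀ t, 0 < t → HasDerivAt x (A.mulVec (x t) + f t) t) →
      ExpBounded c f →
      ExpBounded c (fun t => (aeval A (s.map fun μ => X - C μ).prod).mulVec (x t)) →
      ExpBounded c x := by
  induction s using Multiset.induction_on with
  | empty =>
    intro _
    refine ⟨1, one_pos, fun c _ x f _ _ _ h => ?_⟩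
    simpa using h
  | cons μ s ih =>
    intro hs
    obtain ⟨c₀, hc₀, H⟩ := ih fun ν hν => hs ν (Multiset.mem_cons_of_mem hν)
    have hμ : μ.re < 0 := hs μ (Multiset.mem_cons_self μ s)
    -- Half of -Re μ keeps c strictly below -Re μ, as the scalar estimate requires.
    refine ⟨min c₀ (-μ.re / 2), by simp [hc₀, hμ], fun c hc x f hx hd hf hp => ?_⟩
    let B : Matrix (Fin n) (Fin n) ℂ := aeval A (X - C μ)
    have hB : ∀ v, B.mulVec v = A.mulVec v - μ • v := fun v => by
      have : B = A - μ • 1 := by simp [B, Algebra.algebraMap_eq_smul_one]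
      rw [this, Matrix.sub_mulVec, Matrix.smul_mulVec, Matrix.one_mulVec]
    have hAB : A * B = B * A := by simp [B, mul_sub, sub_mul, Algebra.commutes]
    have hy : ExpBounded c (fun t => B.mulVec (x t)) := by
      refine H c (hc.trans (min_le_left _ _)) _ (fun t => B.mulVec (f t)) ?_ ?_
        (expBounded_mulVec hf B) ?_
      · exact (LinearMap.continuous_of_finiteDimensional (Matrix.mulVecLin B)).comp_continuousOn hx
      · intro t ht
        have := hasDerivAt_mulVec (hd t ht) B
        rwa [Matrix.mulVec_add, Matrix.mulVec_mulVec, ← hAB, ← Matrix.mulVec_mulVec] at this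
      · simpa [B, Matrix.mulVec_mulVec, mul_comm (X - C μ)] using hp
    rw [expBounded_pi_iff]
    intro i
    have hyi := expBounded_pi_iff.1 (hy.add hf) i
    refine expBounded_of_hasDerivAt_mul_add (μ := μ) ?_ ((continuous_apply i).comp_continuousOn hx)
      (fun t ht => ?_) hyi
    · have := hc.trans (min_le_right _ _)
      linarith
    · have := hasDerivAt_pi.1 (hd t ht) i
      refine this.congr_deriv ?_
      simp only [hB, Pi.add_apply, Pi.sub_apply, Pi.smul_apply, smul_eq_mul]
      ring

/-- After complexification, take all roots of the characteristic polynomial in the previous lemma: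
by Cayley–Hamilton the product of the factors vanishes, so its last hypothesis is trivial. -/
theorem IsHurwitz.exists_expBounded {n : ℕ} {A : Matrix (Fin n) (Fin n) ℝ} (hA : IsHurwitz A) :
    ∃ c₀ > (0 : ℝ), ∀ c ≤ c₀, ∀ x f : ℝ → Vec n, ContinuousOn x (Ici 0) →
      (∀ t, 0 < t → HasDerivAt x (mulVecL A (x t) + f t) t) → ExpBounded c f →
      ExpBounded c x := by
  set A' := A.map (algebraMap ℝ ℂ) with hA'
  have hroots : ∀ μ ∈ A'.charpoly.roots, μ.re < 0 := fun μ hμ =>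
    hA μ (Matrix.mem_spectrum_iff_isRoot_charpoly.2 (Polynomial.isRoot_of_mem_roots hμ))
  obtain ⟨c₀, hc₀, H⟩ := exists_expBounded_of_aeval_prod A' _ hroots
  refine ⟨c₀, hc₀, fun c hc x f hx hd hf => ?_⟩
  let J : Vec n →L[ℝ] (Fin n → ℂ) :=
    ContinuousLinearMap.pi fun i => Complex.ofRealCLM.comp (EuclideanSpace.proj i)
  have hJ : ∀ v i, J v i = (v i : ℂ) := fun v i => rfl
  have hJA : ∀ v, J (mulVecL A v) = A'.mulVec (J v) := by
    intro v
    ext i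
    simp [hJ, mulVecL, A', Matrix.mulVec, dotProduct]
  have hprod : (A'.charpoly.roots.map fun μ => X - C μ).prod = A'.charpoly :=
    ((IsAlgClosed.splits A'.charpoly).eq_prod_roots_of_monic A'.charpoly_monic).symm
  have hJx := H c hc (fun t => J (x t)) (fun t => J (f t)) (J.continuous.comp_continuousOn hx)
    (fun t ht => by
      have := J.hasFDerivAt.comp_hasDerivAt t (hd t ht)
      rwa [map_add, hJA] at this)
    (hf.clm_apply J) (by
      rw [hprod, Matrix.aeval_self_charpoly]
      exact ⟨0, fun t _ => by simp⟩)
  -- The factor √n compares the Euclidean norm with the sup norm on `Fin n → ℂ`.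
  refine hJx.of_le_mul (g := x) (K := Real.sqrt n) (Real.sqrt_nonneg _) fun t _ => ?_
  rw [EuclideanSpace.norm_eq, ← Real.sqrt_sq (norm_nonneg (J (x t))), ← Real.sqrt_mul (by simp)]
  apply Real.sqrt_le_sqrt
  calc ∑ i, ‖x t i‖ ^ 2 ≤ ∑ _i : Fin n, ‖J (x t)‖ ^ 2 := by
        apply Finset.sum_le_sum
        intro i _
        have : ‖x t i‖ = ‖J (x t) i‖ := by simp [hJ]
        rw [this]
        gcongr
        exact norm_le_pi_norm _ i
    _ = n * ‖J (x t)‖ ^ 2 := by simp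

end Hurwitz

/-! ### The adaptive law -/

theorem inner_mulVecL_left {m n : ℕ} (B : Matrix (Fin m) (Fin n) ℝ) (x : Vec n) (y : Vec m) :
    inner ℝ (mulVecL B x) y = inner ℝ x (mulVecL B.conjTranspose y) := by
  have h := Matrix.toEuclideanLin_conjTranspose_eq_adjoint B
  simp only [mulVecL, LinearMap.coe_toContinuousLinearMap', h, LinearMap.adjoint_inner_right]

theorem mulVecL_one {n : ℕ} (x : Vec n) : mulVecL (1 : Matrix (Fin n) (Fin n) ℝ) x = x := by
  ext i
  simp [mulVecL]

open scoped MatrixOrder in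
/-- A positive definite matrix `Γ` has `Γ⁻¹ = Cᵀ C` with `C` invertible. -/
theorem exists_factor_inv_posDef {n : ℕ} {Γ : Matrix (Fin n) (Fin n) ℝ} (hΓ : Γ.PosDef) :
    ∃ C D : Vec n →L[ℝ] Vec n, (∀ x, D (C x) = x) ∧
      ∀ x y, inner ℝ (C x) (C (mulVecL Γ y)) = inner ℝ x y := by
  obtain ⟨B, hB⟩ := CStarAlgebra.nonneg_iff_eq_star_mul_self.1
    (Matrix.nonneg_iff_posSemidef.2 hΓ.inv.posSemidef)
  have hΓu : IsUnit Γ.det := (Matrix.isUnit_iff_isUnit_det Γ).1 hΓ.isUnit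
  have hBu : IsUnit B.det := by
    have h1 : IsUnit (Γ⁻¹).det := (Matrix.isUnit_iff_isUnit_det _).1 hΓ.inv.isUnit
    rw [hB, Matrix.det_mul] at h1
    exact isUnit_of_mul_isUnit_right h1
  refine ⟨mulVecL B, mulVecL B⁻¹, fun x => ?_, fun x y => ?_⟩
  · rw [← mulVecL_mul, Matrix.nonsing_inv_mul B hBu, mulVecL_one]
  · rw [inner_mulVecL_left, ← mulVecL_mul, ← Matrix.star_eq_conjTranspose, ← hB, ← mulVecL_mul,
      Matrix.nonsing_inv_mul Γ hΓu, mulVecL_one]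

/-- Evaluation of a matrix at a vector, as a linear map in the matrix. -/
noncomputable def mulVecEval {n : ℕ} (x : Vec n) : Matrix (Fin n) (Fin n) ℝ →ₗ[ℝ] Vec n where
  toFun M := mulVecL M x
  map_add' M N := by simp [mulVecL]
  map_smul' c M := by simp [mulVecL]

theorem continuousOn_mulVecL_apply {n : ℕ} {R : ℝ → Matrix (Fin n) (Fin n) ℝ} {s : Set ℝ}
    (hR : ContinuousOn R s) (x : Vec n) : ContinuousOn (fun t => mulVecL (R t) x) s :=
  (mulVecEval x).continuous_of_finiteDimensional.comp_continuousOn hR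

theorem hasDerivAt_mulVecL_apply {n : ℕ} {R : ℝ → Matrix (Fin n) (Fin n) ℝ}
    {R' : Matrix (Fin n) (Fin n) ℝ} {t : ℝ} (hR : HasDerivAt R R' t) (x : Vec n) :
    HasDerivAt (fun t => mulVecL (R t) x) (mulVecL R' x) t := by
  -- The derivative is read in the normed space of functions, where the chain rule for a continuous
  -- linear map applies.
  let T : (Fin n → Fin n → ℝ) →ₗ[ℝ] Vec n :=
    mulVecEval x ∘ₗ (Matrix.ofLinearEquiv ℝ).toLinearMap
  have hR' : HasDerivAt (F := Fin n → Fin n → ℝ) R R' t := hR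
  exact (LinearMap.toContinuousLinearMap T).hasFDerivAt.comp_hasDerivAt t hR'

theorem mulVecL_filter {n : ℕ} (R : Matrix (Fin n) (Fin n) ℝ) (a b : ℝ) (v x : Vec n) :
    mulVecL (a • R + b • Matrix.vecMulVec v v) x
      = a • mulVecL R x + (b * inner ℝ v x) • v := by
  ext i
  simp [mulVecL, Matrix.vecMulVec_mulVec, PiLp.inner_apply, dotProduct, mul_comm]
  ring

/-- The solution `R` of the matrix filter driven by the normalized `φφᵀ`. -/
structure IsGramFilter {n : ℕ} (ψ : ℝ) (φ : ℝ → Vec n) (R : ℝ → Matrix (Fin n) (Fin n) ℝ) :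
    Prop where
  cont : ContinuousOn R (Ici 0)
  ode : ∀ t, 0 < t → HasDerivAt R
    (-ψ • R t + (1 + ‖φ t‖ ^ 2)⁻¹ • Matrix.vecMulVec (φ t) (φ t)) t

namespace IsGramFilter

variable {n : ℕ} {ψ : ℝ} {φ : ℝ → Vec n} {R : ℝ → Matrix (Fin n) (Fin n) ℝ}

theorem hasDerivAt_apply (h : IsGramFilter ψ φ R) (x : Vec n) {t : ℝ} (ht : 0 < t) :
    HasDerivAt (fun t => mulVecL (R t) x)
      (-ψ • mulVecL (R t) x + ((1 + ‖φ t‖ ^ 2)⁻¹ * inner ℝ (φ t) x) • φ t) t := by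
  rw [← mulVecL_filter]
  exact hasDerivAt_mulVecL_apply (h.ode t ht) x

theorem continuousOn_weighted (h : IsGramFilter ψ φ R) (x : Vec n) :
    ContinuousOn (fun t => Real.exp (ψ * t) * inner ℝ x (mulVecL (R t) x)) (Ici 0) := by
  apply ContinuousOn.mul (by fun_prop)
  exact continuousOn_const.inner (continuousOn_mulVecL_apply h.cont x)

/-- The integrating factor exp(ψt) cancels -ψR and leaves only the nonnegative rank-one source, so
the weighted quadratic form is monotone. -/
theorem hasDerivAt_weighted (h : IsGramFilter ψ φ R) (x : Vec n) {t : ℝ} (ht : 0 < t) :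
    HasDerivAt (fun t => Real.exp (ψ * t) * inner ℝ x (mulVecL (R t) x))
      (Real.exp (ψ * t) * ((1 + ‖φ t‖ ^ 2)⁻¹ * (inner ℝ (φ t) x) ^ 2)) t := by
  have h1 := (innerSL ℝ x).hasFDerivAt.comp_hasDerivAt t (h.hasDerivAt_apply x ht)
  refine ((hasDerivAt_exp_mul ψ t).mul h1).congr_deriv ?_
  simp only [Function.comp_apply, innerSL_apply_apply, inner_add_right, inner_smul_right,
    real_inner_comm x (φ t)]
  ring

/-- `R 0` is arbitrary, so `R t` need not be positive semidefinite; monotonicity of the weighted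
form shows that its negative part is only the decaying memory of `R 0`. -/
theorem neg_le_inner (h : IsGramFilter ψ φ R) (x : Vec n) {t : ℝ} (ht : 0 ≤ t) :
    -(‖mulVecL (R 0)‖ * Real.exp (-ψ * t) * ‖x‖ ^ 2) ≤ inner ℝ x (mulVecL (R t) x) := by
  have hm := monotoneOn_Ici_of_hasDerivAt_nonneg (h.continuousOn_weighted x)
    (fun t ht => h.hasDerivAt_weighted x ht) (fun t _ => by positivity)
    self_mem_Ici (mem_Ici.2 ht) ht
  simp only [mul_zero, Real.exp_zero, one_mul] at hm
  have h1 : -(‖mulVecL (R 0)‖ * ‖x‖ ^ 2) ≤ inner ℝ x (mulVecL (R 0) x) := by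
    have h2 := abs_le.1 (abs_real_inner_le_norm x (mulVecL (R 0) x))
    have h3 := mul_le_mul_of_nonneg_left ((mulVecL (R 0)).le_opNorm x) (norm_nonneg x)
    nlinarith [h2.1]
  have h4 := mul_le_mul_of_nonneg_left (h1.trans hm) (Real.exp_pos (-ψ * t)).le
  rw [← mul_assoc, ← Real.exp_add] at h4
  have e : -ψ * t + ψ * t = 0 := by ring
  rw [e, Real.exp_zero, one_mul] at h4
  linarith

/-- Excitation passes to R: over the last window [t - T, t] the filter accumulates the excitation
integral, discounted at worst by exp(-ψT) and by the normalization (1 + K²)⁻¹, while the value at t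
- T contributes only the memory of `R 0`. -/
theorem exists_le_inner (h : IsGramFilter ψ φ R) (hψ : 0 < ψ) (hφ : ContinuousOn φ (Ici 0))
    (hb : BoundedOnHalfLine φ) (hpe : PersistentlyExciting φ) :
    ∃ T > (0 : ℝ), ∃ κ > (0 : ℝ), ∀ t, T ≤ t → ∀ x : Vec n,
      κ * ‖x‖ ^ 2 - ‖mulVecL (R 0)‖ * Real.exp (-ψ * t) * ‖x‖ ^ 2
        ≤ inner ℝ x (mulVecL (R t) x) := by
  obtain ⟨T, hT, α, hα, H⟩ := hpe
  obtain ⟨K, hK⟩ := hb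
  refine ⟨T, hT, Real.exp (-ψ * T) * ((1 + K ^ 2)⁻¹ * α), by positivity, fun t ht x => ?_⟩
  set s := t - T with hs
  have hs0 : 0 ≤ s := sub_nonneg.2 ht
  -- Clamping the time at 0 makes the integrand continuous on all of ℝ, so that its primitive is
  -- differentiable.
  let ι : ℝ → ℝ := fun r => inner ℝ (φ (max r 0)) x ^ 2
  have hι : Continuous ι := by
    have : Continuous fun r => φ (max r 0) :=
      hφ.comp_continuous (by fun_prop) fun r => le_max_right r 0
    exact (this.inner continuous_const).pow 2
  have hιe : ∀ r, 0 ≤ r → ι r = inner ℝ (φ r) x ^ 2 := fun r hr => by simp [ι, hr]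
  have hm := monotoneOn_Ici_of_hasDerivAt_nonneg (s := s)
    (u := fun r => Real.exp (ψ * r) * inner ℝ x (mulVecL (R r) x)
      - Real.exp (ψ * s) * (1 + K ^ 2)⁻¹ * ∫ τ in s..r, ι τ)
    (((h.continuousOn_weighted x).mono (Ici_subset_Ici.2 hs0)).sub
      (Continuous.continuousOn (continuous_const.mul
        (intervalIntegral.continuous_primitive (fun a b => hι.intervalIntegrable a b) s))))
    (fun r hr => (h.hasDerivAt_weighted x (hs0.trans_lt hr)).sub
      ((intervalIntegral.integral_hasDerivAt_right (hι.intervalIntegrable _ _)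
        hι.stronglyMeasurable.stronglyMeasurableAtFilter hι.continuousAt).const_mul _))
    (fun r hr => by
      have hr0 : 0 ≤ r := hs0.trans hr.le
      rw [hιe r hr0, sub_nonneg, ← mul_assoc]
      gcongr
      exact hK r hr0)
    self_mem_Ici (mem_Ici.2 (show s ≤ t by linarith)) (by linarith)
  simp only [intervalIntegral.integral_same, mul_zero, sub_zero] at hm
  have h1 : α * ‖x‖ ^ 2 ≤ ∫ τ in s..t, ι τ := by
    have h2 := H s hs0 x
    have e : s + T = t := by ring
    rw [e] at h2
    refine h2.trans_eq (intervalIntegral.integral_congr fun r hr => ?_)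
    rw [uIcc_of_le (by linarith)] at hr
    exact (hιe r (hs0.trans hr.1)).symm
  have h3 := h.neg_le_inner x hs0
  have h4 : Real.exp (ψ * s) * (1 + K ^ 2)⁻¹ * (α * ‖x‖ ^ 2)
      ≤ Real.exp (ψ * s) * (1 + K ^ 2)⁻¹ * ∫ τ in s..t, ι τ := by gcongr
  have h5 := mul_le_mul_of_nonneg_left h3 (Real.exp_pos (ψ * s)).le
  have e0 : Real.exp (ψ * s) = Real.exp (ψ * t) * Real.exp (-ψ * T) := by
    rw [← Real.exp_add, hs]; ring_nf
  have e1 : Real.exp (ψ * s) * Real.exp (-ψ * s) = 1 := by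
    rw [← Real.exp_add]; simp
  have e2 : Real.exp (ψ * t) * Real.exp (-ψ * t) = 1 := by
    rw [← Real.exp_add]; simp
  have h6 : Real.exp (ψ * t) * (Real.exp (-ψ * T) * ((1 + K ^ 2)⁻¹ * α) * ‖x‖ ^ 2
      - ‖mulVecL (R 0)‖ * Real.exp (-ψ * t) * ‖x‖ ^ 2)
      ≤ Real.exp (ψ * t) * inner ℝ x (mulVecL (R t) x) := by
    have a1 : Real.exp (ψ * t) * (Real.exp (-ψ * T) * ((1 + K ^ 2)⁻¹ * α) * ‖x‖ ^ 2
      - ‖mulVecL (R 0)‖ * Real.exp (-ψ * t) * ‖x‖ ^ 2)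
      = Real.exp (ψ * s) * (1 + K ^ 2)⁻¹ * (α * ‖x‖ ^ 2)
        - (Real.exp (ψ * t) * Real.exp (-ψ * t)) * (‖mulVecL (R 0)‖ * ‖x‖ ^ 2) := by
      rw [e0]; ring
    have a2 : Real.exp (ψ * s) * -(‖mulVecL (R 0)‖ * Real.exp (-ψ * s) * ‖x‖ ^ 2)
      = - ((Real.exp (ψ * s) * Real.exp (-ψ * s)) * (‖mulVecL (R 0)‖ * ‖x‖ ^ 2)) := by ring
    rw [a1, e2]
    rw [a2, e1] at h5
    linarith
  exact le_of_mul_le_mul_left h6 (Real.exp_pos _)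

end IsGramFilter

/-- The error of a gradient estimator driven by a Gram filter and an exponentially decaying
perturbation is bounded, and decays exponentially under persistent excitation. -/
theorem gradient_estimator_error {n : ℕ} {ψ c : ℝ} {Γ : Matrix (Fin n) (Fin n) ℝ} {φ : ℝ → Vec n}
    {R : ℝ → Matrix (Fin n) (Fin n) ℝ} {q x : ℝ → Vec n} (hψ : 0 < ψ) (hc : 0 < c)
    (hΓ : Γ.PosDef) (hR : IsGramFilter ψ φ R) (hφ : ContinuousOn φ (Ici 0))
    (hb : BoundedOnHalfLine φ) (hq : ExpBounded c q) (hx : ContinuousOn x (Ici 0))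
    (hd : ∀ t, 0 < t → HasDerivAt x (mulVecL Γ (q t - mulVecL (R t) (x t))) t) :
    BoundedOnHalfLine x ∧ (PersistentlyExciting φ → ∃ c' > (0 : ℝ), ExpBounded c' x) := by
  -- ‖C x‖² = ⟨x, Γ⁻¹x⟩ is the Lyapunov function; in it the gain Γ disappears from the derivative.
  obtain ⟨C, D, hDC, hC⟩ := exists_factor_inv_posDef hΓ
  set a := min ψ c with ha
  have ha0 : 0 < a := lt_min hψ hc
  obtain ⟨q₀, hq₀, hq⟩ := hq.exists_nonneg
  set r := ‖mulVecL (R 0)‖ with hr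
  have hr0 : 0 ≤ r := norm_nonneg _
  have hs : ContinuousOn (fun t => C (x t)) (Ici 0) := C.continuous.comp_continuousOn hx
  have hsd : ∀ t, 0 < t → HasDerivAt (fun t => C (x t))
      (C (mulVecL Γ (q t - mulVecL (R t) (x t)))) t := fun t ht =>
    C.hasFDerivAt.comp_hasDerivAt t (hd t ht)
  have hxC : ∀ t, ‖x t‖ ≤ ‖D‖ * ‖C (x t)‖ := fun t => by
    conv_lhs => rw [← hDC (x t)]
    exact D.le_opNorm _
  have hin : ∀ t, 0 ≤ t → inner ℝ (C (x t)) (C (mulVecL Γ (q t - mulVecL (R t) (x t))))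
      ≤ q₀ * Real.exp (-a * t) * ‖x t‖ - inner ℝ (x t) (mulVecL (R t) (x t)) := by
    intro t ht
    rw [hC, inner_sub_right]
    have h1 := real_inner_le_norm (x t) (q t)
    have h2 : ‖q t‖ ≤ q₀ * Real.exp (-a * t) := by
      refine (hq t ht).trans ?_
      gcongr
      exact min_le_right _ _
    have h3 := mul_le_mul_of_nonneg_left h2 (norm_nonneg (x t))
    linarith
  have hrexp : ∀ t, 0 ≤ t → r * Real.exp (-ψ * t) * ‖x t‖ ^ 2
      ≤ r * Real.exp (-a * t) * ‖x t‖ ^ 2 := fun t ht => by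
    gcongr
    exact min_le_left _ _
  have hsb : BoundedOnHalfLine (fun t => C (x t)) := by
    refine bounded_of_inner_deriv_le (C := q₀ * ‖D‖ + r * ‖D‖ ^ 2) ha0 hs hsd fun t ht => ?_
    have h1 := hin t ht.le
    have h2 := hR.neg_le_inner (x t) ht.le
    have h3 := hrexp t ht.le
    have hE := Real.exp_pos (-a * t)
    have h4 : q₀ * Real.exp (-a * t) * ‖x t‖
        ≤ q₀ * Real.exp (-a * t) * (‖D‖ * (‖C (x t)‖ ^ 2 + 1)) := by
      gcongr
      refine (hxC t).trans ?_
      gcongr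
      nlinarith [sq_nonneg (‖C (x t)‖ - 1)]
    have h5 : r * Real.exp (-a * t) * ‖x t‖ ^ 2
        ≤ r * Real.exp (-a * t) * (‖D‖ ^ 2 * (‖C (x t)‖ ^ 2 + 1)) := by
      gcongr
      calc ‖x t‖ ^ 2 ≤ (‖D‖ * ‖C (x t)‖) ^ 2 := by gcongr; exact hxC t
        _ = ‖D‖ ^ 2 * ‖C (x t)‖ ^ 2 := by ring
        _ ≤ _ := by gcongr; linarith
    calc _ ≤ _ := h1
      _ ≤ q₀ * Real.exp (-a * t) * (‖D‖ * (‖C (x t)‖ ^ 2 + 1))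
        + r * Real.exp (-a * t) * (‖D‖ ^ 2 * (‖C (x t)‖ ^ 2 + 1)) := by linarith
      _ = _ := by ring
  have hxb : BoundedOnHalfLine x := by
    rw [← expBounded_zero_iff] at hsb ⊢
    exact hsb.of_le_mul (norm_nonneg D) fun t _ => hxC t
  refine ⟨hxb, fun hpe => ?_⟩
  obtain ⟨T, hT, κ, hκ, H⟩ := hR.exists_le_inner hψ hφ hb hpe
  rw [← expBounded_zero_iff] at hsb hxb
  obtain ⟨s₀, hs₀, hsb⟩ := hsb.exists_nonneg
  obtain ⟨x₀, hx₀, hxb⟩ := hxb.exists_nonneg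
  simp only [neg_zero, zero_mul, Real.exp_zero, mul_one] at hsb hxb
  set k := κ / (‖C‖ ^ 2 + 1) with hk
  have hk0 : 0 < k := by positivity
  -- Half of k keeps the rate strictly below the damping k, while a limits it to the decay of q and
  -- of the memory of `R 0`.
  set c' := min a (k / 2) with hc'
  have hc'0 : 0 < c' := lt_min ha0 (by positivity)
  have hkx : ∀ t, k * ‖C (x t)‖ ^ 2 ≤ κ * ‖x t‖ ^ 2 := fun t => by
    have h1 : ‖C (x t)‖ ^ 2 ≤ (‖C‖ ^ 2 + 1) * ‖x t‖ ^ 2 := by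
      calc ‖C (x t)‖ ^ 2 ≤ (‖C‖ * ‖x t‖) ^ 2 := by gcongr; exact C.le_opNorm _
        _ = ‖C‖ ^ 2 * ‖x t‖ ^ 2 := by ring
        _ ≤ _ := by gcongr; linarith
    calc k * ‖C (x t)‖ ^ 2 ≤ k * ((‖C‖ ^ 2 + 1) * ‖x t‖ ^ 2) := by gcongr
      _ = κ * ‖x t‖ ^ 2 := by rw [hk]; field_simp
  have hcs : ExpBounded c' (fun t => C (x t)) := by
    refine expBounded_of_inner_deriv_le (a := k)
      -- The second summand serves for t ≤ T, before a full excitation window has passed: there the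
      -- missing damping term is simply bounded using s₀, and exp(c'T) offsets exp(-c't).
      (C := (q₀ + r * x₀) * ‖D‖ + k * s₀ * Real.exp (c' * T))
      ((min_le_right _ _).trans_lt (by linarith)) hs hsd fun t ht => ?_
    have h1 := hin t ht.le
    have h3 := hrexp t ht.le
    have h4 : q₀ * Real.exp (-a * t) * ‖x t‖ + r * Real.exp (-a * t) * ‖x t‖ ^ 2
        ≤ (q₀ + r * x₀) * ‖D‖ * Real.exp (-c' * t) * ‖C (x t)‖ := by
      calc q₀ * Real.exp (-a * t) * ‖x t‖ + r * Real.exp (-a * t) * ‖x t‖ ^ 2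
          = (q₀ + r * ‖x t‖) * Real.exp (-a * t) * ‖x t‖ := by ring
        _ ≤ (q₀ + r * x₀) * Real.exp (-c' * t) * (‖D‖ * ‖C (x t)‖) := by
          gcongr
          · exact hxb t ht.le
          · exact min_le_left _ _
          · exact hxC t
        _ = _ := by ring
    have h5 : 0 ≤ k * s₀ * Real.exp (c' * T) * Real.exp (-c' * t) * ‖C (x t)‖ := by positivity
    rcases le_total T t with htT | htT
    · have h2 := H t htT (x t)
      have h6 := hkx t
      linarith
    · have h2 := hR.neg_le_inner (x t) ht.le
      have h6 : k * ‖C (x t)‖ ^ 2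
          ≤ k * s₀ * Real.exp (c' * T) * Real.exp (-c' * t) * ‖C (x t)‖ := by
        have h7 : 1 ≤ Real.exp (c' * T) * Real.exp (-c' * t) := by
          rw [← Real.exp_add]
          apply Real.one_le_exp
          nlinarith
        calc k * ‖C (x t)‖ ^ 2 = k * ‖C (x t)‖ * 1 * ‖C (x t)‖ := by ring
          _ ≤ k * s₀ * (Real.exp (c' * T) * Real.exp (-c' * t)) * ‖C (x t)‖ := by
            gcongr
            exact hsb t ht.le
          _ = _ := by ring
      linarith
  exact ⟨c', hc'0, hcs.of_le_mul (norm_nonneg D) fun t _ => hxC t⟩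

/-! ### The linear regression behind the identifier -/

namespace System

variable {nX nz nU : ℕ} {S : System nX nz nU} {ρ ψ : ℝ} {Γ : Matrix (Fin nz) (Fin nz) ℝ}
  {U : ℝ → Vec nU} {w : ℝ → SpaceY nX nz} {ζ₁ ζ₂ : ℝ → ℝ} {φ : ℝ → Vec nz}
  {R : ℝ → Matrix (Fin nz) (Fin nz) ℝ} {Q θhat : ℝ → Vec nz}

/-- Because Θ is diagonal, 1ᵀΘ = θᵀ: summing the components makes the measurement affine in the
unknown θ, with regressor ϕ. -/
theorem sum_meas₂ (t : ℝ) :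
    ∑ i, S.meas₂ U w t i
      = ∑ i, deriv (S.meas₁ U w) t i - inner ℝ S.θ (S.regressor U w t) := by
  rw [PiLp.inner_apply, ← Finset.sum_sub_distrib]
  refine Finset.sum_congr rfl fun i _ => ?_
  simp only [meas₂, regressor, Theta, Matrix.mul_assoc, mulVecL_mul (Matrix.diagonal _)]
  simp [mulVecL, Matrix.mulVec_diagonal]
  ring

theorem IsIdentifier.isGramFilter (hid : S.IsIdentifier ρ ψ Γ U w ζ₁ ζ₂ φ R Q θhat) :
    IsGramFilter ψ φ R :=
  ⟨hid.R_continuousOn, hid.R_ode⟩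

/-- The regression error solves δ' = -ρδ exactly: the derivative of Z₁ and the term ⟨θ, ϕ⟩ both
cancel, so no bound on the derivative of Y₁ is needed. -/
theorem IsIdentifier.expBounded_filter_error (hid : S.IsIdentifier ρ ψ Γ U w ζ₁ ζ₂ φ R Q θhat)
    {c : ℝ} (hc : c < ρ) (hYc : ContinuousOn (S.meas₁ U w) (Ici 0))
    (hYd : ∀ t, 0 < t → DifferentiableAt ℝ (S.meas₁ U w) t) :
    ExpBounded c fun t => ∑ i, S.meas₁ U w t i - (ζ₁ t + ζ₂ t) - inner ℝ S.θ (φ t) := by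
  refine expBounded_of_hasDerivAt_neg_smul_add (a := ρ) (g := fun _ => 0) hc ?_ (fun t ht => ?_)
    ⟨0, fun t _ => by simp⟩
  · refine ((continuousOn_finsetSum _ fun i _ => ?_).sub
      (hid.ζ₁_continuousOn.add hid.ζ₂_continuousOn)).sub
      (continuousOn_const.inner hid.φ_continuousOn)
    exact (EuclideanSpace.proj i : Vec nz →L[ℝ] ℝ).continuous.comp_continuousOn hYc
  · have hZ : HasDerivAt (fun t => ∑ i, S.meas₁ U w t i) (∑ i, deriv (S.meas₁ U w) t i) t :=
      HasDerivAt.fun_sum fun i _ => (EuclideanSpace.proj i : Vec nz →L[ℝ] ℝ).hasFDerivAt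
        |>.comp_hasDerivAt t (hYd t ht).hasDerivAt
    have hθ := (innerSL ℝ S.θ).hasFDerivAt.comp_hasDerivAt t (hid.φ_ode t ht)
    refine ((hZ.sub ((hid.ζ₁_ode t ht).add (hid.ζ₂_ode t ht))).sub hθ).congr_deriv ?_
    rw [sum_meas₂]
    simp only [innerSL_apply_apply, inner_add_right, inner_smul_right, smul_eq_mul]
    ring

theorem IsIdentifier.bounded_filter (hid : S.IsIdentifier ρ ψ Γ U w ζ₁ ζ₂ φ R Q θhat)
    (hρ : 0 < ρ) (hreg : BoundedOnHalfLine (S.regressor U w)) : BoundedOnHalfLine φ := by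
  rw [← expBounded_zero_iff] at hreg ⊢
  exact expBounded_of_hasDerivAt_neg_smul_add hρ hid.φ_continuousOn hid.φ_ode hreg

/-- The parameter error is bounded, and decays exponentially under persistent excitation. -/
theorem IsIdentifier.parameter_error (hid : S.IsIdentifier ρ ψ Γ U w ζ₁ ζ₂ φ R Q θhat)
    (hρ : 0 < ρ) (hψ : 0 < ψ) (hΓ : Γ.PosDef) (hYc : ContinuousOn (S.meas₁ U w) (Ici 0))
    (hYd : ∀ t, 0 < t → DifferentiableAt ℝ (S.meas₁ U w) t)
    (hreg : BoundedOnHalfLine (S.regressor U w)) :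
    BoundedOnHalfLine (fun t => S.θ - θhat t) ∧
      (PersistentlyExciting φ → ∃ c > (0 : ℝ), ExpBounded c fun t => S.θ - θhat t) := by
  obtain ⟨c, hc0, hc⟩ : ∃ c, 0 < c ∧ c < min ρ ψ := exists_between (lt_min hρ hψ)
  have hδ := hid.expBounded_filter_error (hc.trans_le (min_le_left _ _)) hYc hYd
  set δ : ℝ → ℝ := fun t => ∑ i, S.meas₁ U w t i - (ζ₁ t + ζ₂ t) - inner ℝ S.θ (φ t) with hδ'
  -- q = Rθ + Q is the residual of the true parameter in the adaptive law. It obeys q' = -ψq - δφ/(1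
  -- + ‖φ‖²), and the normalization bounds the forcing by |δ| whatever the size of φ.
  have hq : ExpBounded c (fun t => mulVecL (R t) S.θ + Q t) := by
    refine expBounded_of_hasDerivAt_neg_smul_add (a := ψ)
      (g := fun t => -(δ t / (1 + ‖φ t‖ ^ 2)) • φ t) (hc.trans_le (min_le_right _ _))
      ((continuousOn_mulVecL_apply hid.R_continuousOn _).add hid.Q_continuousOn)
      (fun t ht => ?_) (hδ.of_le_mul zero_le_one fun t _ => ?_)
    · refine ((hid.isGramFilter.hasDerivAt_apply S.θ ht).add (hid.Q_ode t ht)).congr_deriv ?_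
      simp only [hδ', real_inner_comm (φ t) S.θ, div_eq_inv_mul]
      module
    · have h1 : 0 < 1 + ‖φ t‖ ^ 2 := by positivity
      rw [norm_smul, norm_neg, norm_div, Real.norm_of_nonneg h1.le, one_mul, div_mul_eq_mul_div,
        div_le_iff₀ h1]
      gcongr
      nlinarith [sq_nonneg (‖φ t‖ - 1)]
  refine gradient_estimator_error hψ hc0 hΓ hid.isGramFilter hid.φ_continuousOn
    (hid.bounded_filter hρ hreg) hq (continuousOn_const.sub hid.θhat_continuousOn) fun t ht => ?_
  refine ((hid.θhat_ode t ht).const_sub S.θ).congr_deriv ?_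
  rw [neg_neg, map_sub (mulVecL (R t))]
  congr 1
  abel

end System

/-! ### Transport equations in a Hilbert space -/

/-- Accretivity makes the cross term in ‖εx + Vx‖² nonnegative. This gives ‖(ε + V)⁻¹V‖ ≤ 1
uniformly in ε. -/
theorem norm_le_norm_smul_add {H : Type*} [NormedAddCommGroup H] [InnerProductSpace ℝ H]
    {V : H →L[ℝ] H} (hV : ∀ x, 0 ≤ inner ℝ (V x) x) {ε : ℝ}
    (hε : 0 ≤ ε) (x : H) : ‖V x‖ ≤ ‖ε • x + V x‖ := by
  refine le_of_sq_le_sq ?_ (norm_nonneg _)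
  rw [norm_add_sq_real, inner_smul_left, real_inner_comm]
  have h1 := mul_nonneg hε (hV x)
  have h2 := sq_nonneg ‖ε • x‖
  simp only [conj_trivial]
  linarith

section Accretive

variable {H : Type*} [NormedAddCommGroup H] [InnerProductSpace ℝ H] [CompleteSpace H]

/-- A bounded accretive operator `V` has a resolvent `(ε + V)⁻¹` for every `ε > 0`. -/
theorem exists_accretive_resolvent {V : H →L[ℝ] H} (hV : ∀ x, 0 ≤ inner ℝ (V x) x) {ε : ℝ}
    (hε : 0 < ε) : ∃ B : H →L[ℝ] H, (∀ x, ε • B x + V (B x) = x) ∧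
      ∀ x, B (ε • x + V x) = x := by
  -- Lax–Milgram: the form ⟨(ε + V)x, y⟩ is coercive with constant ε.
  let b : H →L[ℝ] H →L[ℝ] ℝ := (innerSL ℝ).comp (ε • ContinuousLinearMap.id ℝ H + V)
  have hb : IsCoercive b := ⟨ε, hε, fun u => by
    have := hV u
    simp only [b, ContinuousLinearMap.comp_apply, innerSL_apply_apply, add_apply,
      smul_apply, ContinuousLinearMap.id_apply, inner_add_left,
      inner_smul_left, real_inner_self_eq_norm_mul_norm]
    simp only [conj_trivial]
    linarith⟩
  have he : ∀ x, hb.continuousLinearEquivOfBilin x = ε • x + V x := fun x =>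
    ext_inner_right ℝ fun y => hb.continuousLinearEquivOfBilin_apply x y
  refine ⟨hb.continuousLinearEquivOfBilin.symm.toContinuousLinearMap, fun x => ?_, fun x => ?_⟩
  · rw [← he]
    exact hb.continuousLinearEquivOfBilin.apply_symm_apply x
  · rw [← he]
    exact hb.continuousLinearEquivOfBilin.symm_apply_apply x

/-- If the regularizations `(ε + V)⁻¹ V y` of `y` are bounded by `K`, so is `y`. -/
theorem norm_le_of_resolvent {V : H →L[ℝ] H} (hinj : ∀ x, V x = 0 → x = 0) {y : H} {K : ℝ}
    (h : ∀ ε > (0 : ℝ), ∃ p : H, ε • p + V p = V y ∧ ‖p‖ ≤ K) : ‖y‖ ≤ K := by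
  have hK : 0 ≤ K := by
    obtain ⟨p, -, hp⟩ := h 1 one_pos
    exact (norm_nonneg p).trans hp
  -- Injectivity of V gives V* dense range, so y can be tested against vectors V*x.
  have hdense : (ContinuousLinearMap.adjoint V).range.topologicalClosure = ⊤ := by
    rw [Submodule.topologicalClosure_eq_top_iff, ContinuousLinearMap.orthogonal_range,
      ContinuousLinearMap.adjoint_adjoint]
    rw [Submodule.eq_bot_iff]
    exact fun x hx => hinj x hx
  have hy : y ∈ closure ((ContinuousLinearMap.adjoint V).range : Set H) := by
    rw [← Submodule.topologicalClosure_coe, hdense]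
    trivial
  have key : ‖y‖ * ‖y‖ ≤ ‖y‖ * K := by
    apply le_of_forall_pos_le_add
    intro η hη
    set L := ‖y‖ + K + 1 with hL
    have hL0 : 0 < L := by positivity
    obtain ⟨_, ⟨x, rfl⟩, hx⟩ := Metric.mem_closure_iff.1 hy (η / (2 * L)) (by positivity)
    rw [dist_eq_norm] at hx
    set ε := η / (2 * (‖x‖ + 1) * (K + 1)) with hε
    obtain ⟨p, hp, hpK⟩ := h ε (by positivity)
    have hVr : V (y - p) = ε • p := by rw [map_sub, ← hp]; abel
    -- With y ≈ V*x, the V*x part of ⟨y, y - p⟩ equals ⟨x, V(y - p)⟩ = ε⟨x, p⟩. It is small because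
    -- ε is chosen after x.
    have e : inner ℝ y y = inner ℝ y p + (inner ℝ (y - ContinuousLinearMap.adjoint V x) (y - p)
        + inner ℝ x (ε • p)) := by
      rw [← hVr, inner_sub_left, ContinuousLinearMap.adjoint_inner_left, inner_sub_right]
      ring
    have h1 : inner ℝ y p ≤ ‖y‖ * K :=
      (real_inner_le_norm _ _).trans (by gcongr)
    have h2 : inner ℝ (y - ContinuousLinearMap.adjoint V x) (y - p) ≤ η / 2 := by
      calc _ ≤ _ := real_inner_le_norm _ _
        _ ≤ η / (2 * L) * L := by
          have : ‖y - p‖ ≤ L := (norm_sub_le _ _).trans (by linarith)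
          exact mul_le_mul hx.le this (norm_nonneg _) (by positivity)
        _ = η / 2 := by field_simp
    have h3 : inner ℝ x (ε • p) ≤ η / 2 := by
      calc _ ≤ _ := real_inner_le_norm _ _
        _ = ‖x‖ * (ε * ‖p‖) := by
          rw [norm_smul, Real.norm_of_nonneg (by positivity)]
        _ ≤ (‖x‖ + 1) * (ε * (K + 1)) := by
          gcongr
          · linarith
          · linarith
        _ = η / 2 := by rw [hε]; field_simp
    rw [← real_inner_self_eq_norm_mul_norm, e]
    linarith
  by_contra hlt
  rw [not_le] at hlt
  have : 0 < ‖y‖ := hK.trans_lt hlt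
  exact absurd (le_of_mul_le_mul_left key this) (not_le.2 hlt)

/-- Let `V` be an injective accretive operator (the inverse of `d/dξ`), accretive with constant `κ`
in the weighted inner product of `M`, and commuting with `L` and `F t`. The solutions `z = V y` of
`z' = -L y + F z + V g` then satisfy an exponential bound in the graph norm. -/
theorem expBounded_of_transport {V M N N' L : H →L[ℝ] H} {F : ℝ → H →L[ℝ] H} {κ c K : ℝ}
    {z y g : ℝ → H} (hc : 0 ≤ c) (hV : ∀ x, 0 ≤ inner ℝ (V x) x) (hinj : ∀ x, V x = 0 → x = 0)
    (hVM : ∀ x, κ * ‖M (V x)‖ ^ 2 ≤ inner ℝ (M (V x)) (M x)) (hM : ∀ x, ‖M x‖ ≤ ‖x‖)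
    {m : ℝ} (hm0 : 0 ≤ m) (hm : ∀ x, ‖x‖ ≤ m * ‖M x‖) (hN : ∀ x, N' (N x) = x)
    (hNL : ∀ x y, inner ℝ (N x) (N (L y)) = inner ℝ x y)
    (hLV : ∀ x, L (V x) = V (L x)) (hLM : ∀ x, L (M x) = M (L x))
    (hFV : ∀ t x, F t (V x) = V (F t x)) (hFM : ∀ t x, F t (M x) = M (F t x))
    (hF : ∀ t, 0 ≤ t → ‖F t‖ ≤ K) (hκ : (K + c + 1) * ‖N‖ ^ 2 ≤ κ)
    (hzy : ∀ t, 0 ≤ t → z t = V (y t)) (hz : ContinuousOn z (Ici 0))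
    (hd : ∀ t, 0 < t → HasDerivAt z (-L (y t) + F t (z t) + V (g t)) t) (hg : ExpBounded c g) :
    ExpBounded c y := by
  obtain ⟨C, hC0, hC⟩ := hg.exists_nonneg
  refine ⟨m * ‖N'‖ * Real.sqrt ((‖N‖ * ‖y 0‖) ^ 2 + (‖N‖ * C) ^ 2), fun t ht => ?_⟩
  apply norm_le_of_resolvent hinj
  intro ε hε
  obtain ⟨B, hB1, hB2⟩ := exists_accretive_resolvent hV hε
  have hBV : ∀ x, B (V x) = V (B x) := fun x => by
    rw [← hB2 (V (B x)), ← map_smul, ← map_add, hB1]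
  have hcomm : ∀ T : H →L[ℝ] H, (∀ x, T (V x) = V (T x)) → ∀ x, T (B x) = B (T x) :=
    fun T hT x => by
      conv_rhs => rw [← hB1 x, map_add, map_smul, hT, hB2]
  have hBVn : ∀ x, ‖V (B x)‖ ≤ ‖x‖ := fun x => by
    conv_rhs => rw [← hB1 x]
    exact norm_le_norm_smul_add hV hε.le _
  refine ⟨B (z t), by rw [hB1, hzy t ht], ?_⟩
  -- The energy is ‖NMBz‖². Here Bz = V(By) lies in the range of V, so the weighted accretivity
  -- `hVM` applies, and z, unlike y, is differentiable in time.
  let T : H →L[ℝ] H := N.comp (M.comp B)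
  have hT : ∀ x, T x = N (M (B x)) := fun x => rfl
  have hu0 : ‖T (z 0)‖ ≤ ‖N‖ * ‖y 0‖ := by
    rw [hT, hzy 0 le_rfl, hBV]
    exact (N.le_opNorm _).trans (by gcongr; exact (hM _).trans (hBVn _))
  have hu := norm_le_of_inner_deriv_le (x := fun t => T (z t))
    -- The choice a = c + 1 makes a - c = 1 in the resulting constant, which depends only on N, y(0)
    -- and C, not on ε.
    (x' := fun t => T (-L (y t) + F t (z t) + V (g t))) (a := c + 1) (c := c) (C := ‖N‖ * C)
    (by linarith) (T.continuous.comp_continuousOn hz)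
    (fun t ht => T.hasFDerivAt.comp_hasDerivAt t (hd t ht)) (fun t ht => by
      have h1 : inner ℝ (T (z t)) (T (-L (y t)))
          ≤ -κ * ‖M (B (z t))‖ ^ 2 := by
        have e1 : T (-L (y t)) = -N (L (M (B (y t)))) := by
          rw [hT, map_neg, map_neg, map_neg, ← hcomm L hLV, hLM]
        have h := hVM (B (y t))
        rw [← hBV, ← hzy t ht.le] at h
        rw [e1, hT, inner_neg_right, hNL]
        linarith
      have h2 : inner ℝ (T (z t)) (T (F t (z t))) ≤ K * ‖N‖ ^ 2 * ‖M (B (z t))‖ ^ 2 := by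
        have e1 : T (F t (z t)) = N (F t (M (B (z t)))) := by
          rw [hT, ← hcomm (F t) (hFV t), hFM]
        rw [e1, hT]
        calc _ ≤ _ := real_inner_le_norm _ _
          _ ≤ (‖N‖ * ‖M (B (z t))‖) * (‖N‖ * (K * ‖M (B (z t))‖)) := by
            gcongr
            · exact N.le_opNorm _
            · refine (N.le_opNorm _).trans ?_
              gcongr
              refine ((F t).le_opNorm _).trans ?_
              gcongr
              exact hF t ht.le
          _ = _ := by ring
      have h3 : inner ℝ (T (z t)) (T (V (g t)))
          ≤ ‖N‖ * C * Real.exp (-c * t) * ‖T (z t)‖ := by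
        have e1 : ‖T (V (g t))‖ ≤ ‖N‖ * (C * Real.exp (-c * t)) := by
          rw [hT, hBV]
          refine (N.le_opNorm _).trans ?_
          gcongr
          exact ((hM _).trans (hBVn _)).trans (hC t ht.le)
        calc _ ≤ _ := real_inner_le_norm _ _
          _ ≤ ‖T (z t)‖ * (‖N‖ * (C * Real.exp (-c * t))) := by gcongr
          _ = _ := by ring
      -- By `hκ`, the dissipation κ pays for the zero-order term F and still leaves damping c + 1.
      have h4 : (c + 1) * ‖T (z t)‖ ^ 2 ≤ (κ - K * ‖N‖ ^ 2) * ‖M (B (z t))‖ ^ 2 := by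
        have h5 : ‖T (z t)‖ ≤ ‖N‖ * ‖M (B (z t))‖ := N.le_opNorm _
        calc (c + 1) * ‖T (z t)‖ ^ 2 ≤ (c + 1) * (‖N‖ * ‖M (B (z t))‖) ^ 2 := by gcongr
          _ = (c + 1) * ‖N‖ ^ 2 * ‖M (B (z t))‖ ^ 2 := by ring
          _ ≤ _ := by
            gcongr
            linarith
      rw [map_add, map_add, inner_add_right, inner_add_right]
      linarith) t ht
  simp only [add_sub_cancel_left, div_one] at hu
  calc ‖B (z t)‖ ≤ m * ‖M (B (z t))‖ := hm _
    _ ≤ m * (‖N'‖ * ‖T (z t)‖) := by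
      gcongr
      conv_lhs => rw [← hN (M (B (z t)))]
      exact N'.le_opNorm _
    _ ≤ m * (‖N'‖ * (Real.sqrt ((‖N‖ * ‖y 0‖) ^ 2 + (‖N‖ * C) ^ 2)
        * Real.exp (-c * t))) := by
      gcongr
      refine hu.trans ?_
      gcongr
    _ = _ := by ring

end Accretive

/-! ### The Volterra operator on `L²((0,1); ℝⁿ)` -/

theorem isProbabilityMeasure_unitMeasure : IsProbabilityMeasure unitMeasure := ⟨by simp⟩

section Primitive

variable {n : ℕ}

/-- The primitive of `g` that vanishes at `0`. -/
noncomputable def primitive (g : ℝ → Vec n) (ξ : ℝ) : Vec n := ∫ t in (0 : ℝ)..ξ, g t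

@[simp]
theorem primitive_zero (g : ℝ → Vec n) : primitive g 0 = 0 := by simp [primitive]

theorem intervalIntegrable_of_unit {F : Type*} [NormedAddCommGroup F] {g : ℝ → F}
    (hg : Integrable g unitMeasure) : IntervalIntegrable g volume 0 1 := by
  rw [intervalIntegrable_iff_integrableOn_Ioo_of_le zero_le_one]
  exact hg

theorem intervalIntegrable_of_unit_of_mem {F : Type*} [NormedAddCommGroup F] {g : ℝ → F}
    (hg : Integrable g unitMeasure) {ξ : ℝ} (hξ : ξ ∈ Icc (0 : ℝ) 1) :
    IntervalIntegrable g volume 0 ξ :=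
  (intervalIntegrable_of_unit hg).mono_set (by
    rw [uIcc_of_le hξ.1, uIcc_of_le zero_le_one]
    exact Icc_subset_Icc_right hξ.2)

theorem integral_unitMeasure {F : Type*} [NormedAddCommGroup F] [NormedSpace ℝ F] (g : ℝ → F) :
    ∫ ξ, g ξ ∂unitMeasure = ∫ ξ in (0 : ℝ)..1, g ξ := by
  rw [intervalIntegral.integral_of_le zero_le_one, integral_Ioc_eq_integral_Ioo]

theorem integral_norm_le_norm (g : L2 n) : ∫ ξ, ‖g ξ‖ ∂unitMeasure ≤ ‖g‖ := by
  have := isProbabilityMeasure_unitMeasure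
  rw [integral_norm_eq_lintegral_enorm (Lp.aestronglyMeasurable g),
    ← eLpNorm_one_eq_lintegral_enorm, Lp.norm_def]
  exact ENNReal.toReal_mono (Lp.eLpNorm_ne_top g)
    (eLpNorm_le_eLpNorm_of_exponent_le (by norm_num) (Lp.aestronglyMeasurable g))

theorem norm_primitive_le (g : L2 n) {ξ : ℝ} (hξ : ξ ∈ Icc (0 : ℝ) 1) :
    ‖primitive g ξ‖ ≤ ‖g‖ := by
  refine le_trans ?_ (integral_norm_le_norm g)
  rw [integral_unitMeasure]
  refine (intervalIntegral.norm_integral_le_integral_norm hξ.1).trans ?_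
  exact intervalIntegral.integral_mono_interval le_rfl hξ.1 hξ.2
    (Filter.Eventually.of_forall fun _ => norm_nonneg _)
    (intervalIntegrable_of_unit (integrable_L2 g).norm)

theorem continuousOn_primitive {g : ℝ → Vec n} (hg : Integrable g unitMeasure) :
    ContinuousOn (primitive g) (Icc 0 1) := by
  have hi : IntegrableOn g (uIcc 0 1) volume := by
    rw [uIcc_of_le zero_le_one, integrableOn_Icc_iff_integrableOn_Ioo]
    exact hg
  have := intervalIntegral.continuousOn_primitive_interval hi
  rwa [uIcc_of_le zero_le_one] at this

theorem primitive_congr {f g : ℝ → Vec n} (h : f =ᵐ[unitMeasure] g) {ξ : ℝ}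
    (hξ : ξ ∈ Icc (0 : ℝ) 1) : primitive f ξ = primitive g ξ := by
  simp only [primitive, intervalIntegral.integral_of_le hξ.1, integral_Ioc_eq_integral_Ioo]
  exact integral_congr_ae (ae_restrict_of_ae_restrict_of_subset (Ioo_subset_Ioo_right hξ.2) h)

theorem clm_primitive {m : ℕ} (A : Vec n →L[ℝ] Vec m) {g : ℝ → Vec n}
    (hg : Integrable g unitMeasure) {ξ : ℝ} (hξ : ξ ∈ Icc (0 : ℝ) 1) :
    A (primitive g ξ) = primitive (fun t => A (g t)) ξ :=
  (A.intervalIntegral_comp_comm (intervalIntegrable_of_unit_of_mem hg hξ)).symm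

theorem primitive_apply {g : ℝ → Vec n} (hg : Integrable g unitMeasure) {ξ : ℝ}
    (hξ : ξ ∈ Icc (0 : ℝ) 1) (i : Fin n) : primitive g ξ i = ∫ t in (0 : ℝ)..ξ, g t i :=
  ((EuclideanSpace.proj i : Vec n →L[ℝ] ℝ).intervalIntegral_comp_comm
    (intervalIntegrable_of_unit_of_mem hg hξ)).symm

theorem memLp_primitive (g : L2 n) : MemLp (primitive g) 2 unitMeasure := by
  refine MemLp.of_bound (((continuousOn_primitive (integrable_L2 g)).mono
    Ioo_subset_Icc_self).aestronglyMeasurable measurableSet_Ioo) ‖g‖ ?_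
  filter_upwards [ae_restrict_mem measurableSet_Ioo] with ξ hξ
  exact norm_primitive_le g (Ioo_subset_Icc_self hξ)

/-- The Volterra operator `g ↦ ∫₀^ξ g`. -/
noncomputable def volterra (n : ℕ) : L2 n →L[ℝ] L2 n :=
  LinearMap.mkContinuous
    { toFun := fun g => (memLp_primitive g).toLp
      map_add' := fun f g => by
        rw [← MemLp.toLp_add]
        apply MemLp.toLp_congr
        filter_upwards [ae_restrict_mem measurableSet_Ioo] with ξ hξ
        have hξ' := Ioo_subset_Icc_self hξ
        rw [primitive_congr (Lp.coeFn_add f g) hξ']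
        exact intervalIntegral.integral_add
          (intervalIntegrable_of_unit_of_mem (integrable_L2 f) hξ')
          (intervalIntegrable_of_unit_of_mem (integrable_L2 g) hξ')
      map_smul' := fun c g => by
        rw [RingHom.id_apply, ← MemLp.toLp_const_smul]
        apply MemLp.toLp_congr
        filter_upwards [ae_restrict_mem measurableSet_Ioo] with ξ hξ
        rw [primitive_congr (Lp.coeFn_smul c g) (Ioo_subset_Icc_self hξ)]
        exact intervalIntegral.integral_smul c _ }
    1 fun g => by
      have := isProbabilityMeasure_unitMeasure
      show ‖(memLp_primitive g).toLp‖ ≤ 1 * ‖g‖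
      refine (Lp.norm_le_of_ae_bound (norm_nonneg g) ?_).trans_eq ?_
      · filter_upwards [(memLp_primitive g).coeFn_toLp, ae_restrict_mem measurableSet_Ioo]
          with ξ h1 hξ
        rw [h1]
        exact norm_primitive_le g (Ioo_subset_Icc_self hξ)
      · simp [measureUnivNNReal]

theorem volterra_ae_eq (g : L2 n) : ⇑(volterra n g) =ᵐ[unitMeasure] primitive g :=
  (memLp_primitive g).coeFn_toLp

/-- The continuous primitive vanishes identically on [0, 1], and Lebesgue differentiation recovers g
from it almost everywhere. -/
theorem volterra_injective {g : L2 n} (h : volterra n g = 0) : g = 0 := by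
  have h0 : EqOn (primitive g) (fun _ => 0) (Icc 0 1) := by
    apply Measure.eqOn_Icc_of_ae_eq volume zero_ne_one _
      (continuousOn_primitive (integrable_L2 g)) continuousOn_const
    rw [← restrict_Ioo_eq_restrict_Icc]
    refine (volterra_ae_eq g).symm.trans ?_
    rw [h]
    exact Lp.coeFn_zero _ _ _
  apply Lp.ext
  refine Filter.EventuallyEq.trans ?_ (Lp.coeFn_zero _ _ _).symm
  refine (ae_restrict_iff' measurableSet_Ioo).2 ?_
  filter_upwards [(intervalIntegrable_of_unit (integrable_L2 g)).ae_hasDerivAt_integral]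
    with ξ hξ hξ'
  rw [uIcc_of_le zero_le_one] at hξ
  have h1 : HasDerivAt (primitive g) (g ξ) ξ := hξ (Ioo_subset_Icc_self hξ') 0 (by simp)
  have h2 : HasDerivAt (primitive g) 0 ξ := by
    refine (hasDerivAt_const ξ (0 : Vec n)).congr_of_eventuallyEq ?_
    filter_upwards [Ioo_mem_nhds hξ'.1 hξ'.2] with x hx
    exact h0 (Ioo_subset_Icc_self hx)
  exact h1.unique h2

/-- A matrix constant in ξ commutes with integration in ξ; this lets Λ and the coefficients ΘΣ(v),
which depend on time only, pass through V. -/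
theorem compLp_volterra (A : Vec n →L[ℝ] Vec n) (g : L2 n) :
    A.compLp (volterra n g) = volterra n (A.compLp g) := by
  apply Lp.ext
  filter_upwards [A.coeFn_compLp (volterra n g), volterra_ae_eq g, volterra_ae_eq (A.compLp g),
    ae_restrict_mem measurableSet_Ioo] with ξ h1 h2 h3 hξ
  have hξ' := Ioo_subset_Icc_self hξ
  rw [h1, h2, h3, clm_primitive A (integrable_L2 g) hξ', primitive_congr (A.coeFn_compLp g) hξ']

end Primitive

/-! ### Exponential weights -/

section Weight

variable {n : ℕ}

theorem memLp_exp_smul {k : ℝ} (hk : 0 ≤ k) (f : L2 n) :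
    MemLp (fun ξ => Real.exp (-k * ξ) • f ξ) 2 unitMeasure := by
  refine MemLp.of_le_mul (c := 1) (Lp.memLp f) ?_ ?_
  · exact (show Continuous fun ξ => Real.exp (-k * ξ) by fun_prop).aestronglyMeasurable.smul
      (Lp.aestronglyMeasurable f)
  · filter_upwards [ae_restrict_mem measurableSet_Ioo] with ξ hξ
    rw [norm_smul, Real.norm_of_nonneg (Real.exp_pos _).le]
    gcongr
    exact Real.exp_le_one_iff.2 (by nlinarith [hξ.1])

/-- Multiplication by the weight `ξ ↦ exp (-k * ξ)`. -/
noncomputable def expWeight (n : ℕ) {k : ℝ} (hk : 0 ≤ k) : L2 n →L[ℝ] L2 n :=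
  LinearMap.mkContinuous
    { toFun := fun f => (memLp_exp_smul hk f).toLp
      map_add' := fun f g => by
        rw [← MemLp.toLp_add]
        apply MemLp.toLp_congr
        filter_upwards [Lp.coeFn_add f g] with ξ h
        rw [h, Pi.add_apply, Pi.add_apply, smul_add]
      map_smul' := fun c f => by
        rw [RingHom.id_apply, ← MemLp.toLp_const_smul]
        apply MemLp.toLp_congr
        filter_upwards [Lp.coeFn_smul c f] with ξ h
        rw [h, Pi.smul_apply, Pi.smul_apply, smul_comm] }
    1 fun f => by
      apply Lp.norm_le_mul_norm_of_ae_le_mul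
      filter_upwards [(memLp_exp_smul hk f).coeFn_toLp, ae_restrict_mem measurableSet_Ioo]
        with ξ h hξ
      rw [LinearMap.coe_mk, AddHom.coe_mk, h, norm_smul, Real.norm_of_nonneg (Real.exp_pos _).le]
      gcongr
      exact Real.exp_le_one_iff.2 (by nlinarith [hξ.1])

theorem expWeight_ae_eq {k : ℝ} (hk : 0 ≤ k) (f : L2 n) :
    ⇑(expWeight n hk f) =ᵐ[unitMeasure] fun ξ => Real.exp (-k * ξ) • f ξ :=
  (memLp_exp_smul hk f).coeFn_toLp

theorem norm_expWeight_le {k : ℝ} (hk : 0 ≤ k) (f : L2 n) : ‖expWeight n hk f‖ ≤ ‖f‖ :=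
  ((expWeight n hk).le_of_opNorm_le (LinearMap.mkContinuous_norm_le _ zero_le_one _) f).trans_eq
    (one_mul _)

theorem norm_le_expWeight {k : ℝ} (hk : 0 ≤ k) (f : L2 n) :
    ‖f‖ ≤ Real.exp k * ‖expWeight n hk f‖ := by
  apply Lp.norm_le_mul_norm_of_ae_le_mul
  filter_upwards [expWeight_ae_eq hk f, ae_restrict_mem measurableSet_Ioo] with ξ h hξ
  rw [h, norm_smul, Real.norm_of_nonneg (Real.exp_pos _).le, ← mul_assoc, ← Real.exp_add]
  refine le_mul_of_one_le_left (norm_nonneg _) (Real.one_le_exp ?_)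
  nlinarith [hξ.2]

theorem compLp_expWeight {k : ℝ} (hk : 0 ≤ k) (A : Vec n →L[ℝ] Vec n) (f : L2 n) :
    A.compLp (expWeight n hk f) = expWeight n hk (A.compLp f) := by
  apply Lp.ext
  filter_upwards [A.coeFn_compLp (expWeight n hk f), expWeight_ae_eq hk f,
    expWeight_ae_eq hk (A.compLp f), A.coeFn_compLp f] with ξ h1 h2 h3 h4
  rw [h1, h2, h3, h4, map_smul]

/-- The scalar weighted accretivity estimate for primitives. -/
theorem integral_weighted_primitive_nonneg {f : ℝ → ℝ} (hf : IntervalIntegrable f volume 0 1)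
    (k : ℝ) :
    let v : ℝ → ℝ := fun ξ => Real.exp (-k * ξ) ^ 2 *
      ((∫ t in (0 : ℝ)..ξ, f t) * f ξ - k * (∫ t in (0 : ℝ)..ξ, f t) ^ 2)
    IntervalIntegrable v volume 0 1 ∧ 0 ≤ ∫ ξ in (0 : ℝ)..1, v ξ := by
  intro v
  set F : ℝ → ℝ := fun ξ => ∫ t in (0 : ℝ)..ξ, f t with hF
  have hFac : AbsolutelyContinuousOnInterval F 0 1 :=
    hf.absolutelyContinuousOnInterval_intervalIntegral (by simp)
  have hE : AbsolutelyContinuousOnInterval (fun ξ => Real.exp (-k * ξ)) 0 1 :=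
    ContDiffOn.absolutelyContinuousOnInterval
      (ContDiff.contDiffOn (n := 1) (by fun_prop))
  have hEF := hE.mul hFac
  -- v is the derivative of ½(exp(-kξ)F(ξ))², which vanishes at 0, so its integral is
  -- ½(exp(-k)F(1))².
  have hG := (hEF.mul hEF).const_mul (1 / 2)
  have hae : ∀ᵐ ξ, ξ ∈ uIoc (0 : ℝ) 1 → deriv (fun x => 1 / 2 *
      (Real.exp (-k * x) * F x * (Real.exp (-k * x) * F x))) ξ = v ξ := by
    filter_upwards [hf.ae_hasDerivAt_integral] with ξ hξ hξ'
    have hd : HasDerivAt F (f ξ) ξ := hξ (uIoc_subset_uIcc hξ') 0 (by simp)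
    have he : HasDerivAt (fun s => Real.exp (-k * s)) (-k * Real.exp (-k * ξ)) ξ := by
      simpa [mul_comm] using ((hasDerivAt_id ξ).const_mul (-k)).exp
    have h1 := (((he.mul hd).mul (he.mul hd)).const_mul (1 / 2)).deriv
    refine Eq.trans h1 ?_
    simp only [v, Pi.mul_apply]
    ring
  constructor
  · refine hG.intervalIntegrable_deriv.congr_ae ?_
    exact (ae_restrict_iff' measurableSet_uIoc).2 hae
  · rw [← intervalIntegral.integral_congr_ae hae]
    refine le_of_le_of_eq ?_ hG.integral_deriv_eq_sub.symm
    have h0 : F 0 = 0 := by simp [hF]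
    simp only [Pi.mul_apply, h0]
    nlinarith [mul_self_nonneg (Real.exp (-k * 1) * F 1)]

/-- The Volterra operator is accretive in the weighted inner product. -/
theorem weighted_volterra_accretive {k : ℝ} (hk : 0 ≤ k) (y : L2 n) :
    k * ‖expWeight n hk (volterra n y)‖ ^ 2
      ≤ inner ℝ (expWeight n hk (volterra n y)) (expWeight n hk y) := by
  rw [← sub_nonneg, ← real_inner_self_eq_norm_sq, L2.inner_def, L2.inner_def,
    ← integral_const_mul, ← integral_sub (L2.integrable_inner _ _)
      ((L2.integrable_inner _ _).const_mul k)]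
  have hy := integrable_L2 y
  have hi : ∀ i, IntervalIntegrable (fun ξ => y ξ i) volume 0 1 := fun i =>
    intervalIntegrable_of_unit ((EuclideanSpace.proj i : Vec n →L[ℝ] ℝ).integrable_comp hy)
  have hsum := fun i => integral_weighted_primitive_nonneg (hi i) k
  refine (Finset.sum_nonneg (s := Finset.univ) fun i _ => (hsum i).2).trans_eq ?_
  rw [← intervalIntegral.integral_finsetSum fun i _ => (hsum i).1, ← integral_unitMeasure]
  apply integral_congr_ae
  filter_upwards [expWeight_ae_eq hk (volterra n y), expWeight_ae_eq hk y, volterra_ae_eq y,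
    ae_restrict_mem measurableSet_Ioo] with ξ h1 h2 h3 hξ
  rw [h1, h2, h3]
  simp only [inner_smul_left, inner_smul_right, PiLp.inner_apply, conj_trivial, Finset.mul_sum,
    ← Finset.sum_sub_distrib, ← primitive_apply hy (Ioo_subset_Icc_self hξ)]
  refine Finset.sum_congr rfl fun i _ => ?_
  simp
  ring

theorem volterra_accretive (y : L2 n) : 0 ≤ inner ℝ (volterra n y) y := by
  have h := weighted_volterra_accretive le_rfl y
  have e : ∀ f : L2 n, expWeight n le_rfl f = f := fun f => by
    apply Lp.ext
    filter_upwards [expWeight_ae_eq le_rfl f] with ξ h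
    simp [h]
  rwa [e, e, zero_mul] at h

end Weight

/-! ### `H¹` functions vanishing at the inflow boundary -/

namespace H1

variable {n : ℕ}

theorem rep_eq_primitive (ζ : H1 n) (h0 : rep ζ 0 = 0) {ξ : ℝ} (hξ : ξ ∈ Icc (0 : ℝ) 1) :
    rep ζ ξ = primitive (wderiv ζ) ξ := by
  have hcomp : ∀ i : Fin n, ∃ c : ℝ, ∀ᵐ x ∂unitMeasure,
      toL2 ζ x i = c + ∫ t in (0 : ℝ)..x, wderiv ζ t i := by
    intro i
    let P : Vec n →L[ℝ] ℝ := EuclideanSpace.proj i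
    apply exists_const_add_integral (P.integrable_comp (integrable_L2 _))
      (P.integrable_comp (integrable_L2 _))
    intro η hη
    have hd : Continuous (deriv η) := hη.smooth.continuous_deriv (by simp)
    have h := congrArg P (ζ.2 η hη)
    rw [map_neg, ← P.integral_comp_comm (integrable_smul_L2 hd hη.compact.deriv _),
      ← P.integral_comp_comm (integrable_smul_L2 hη.smooth.continuous hη.compact _)] at h
    simpa [P, toL2, wderiv] using h
  choose c hc using hcomp
  have hu := rep_unique ζ (u := fun x => WithLp.toLp 2 c + primitive (wderiv ζ) x)
    (continuousOn_const.add (continuousOn_primitive (integrable_L2 _))) (by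
      filter_upwards [ae_all_iff.2 hc, ae_restrict_mem measurableSet_Ioo] with x hx hx'
      ext i
      rw [hx, PiLp.add_apply, primitive_apply (integrable_L2 _) (Ioo_subset_Icc_self hx')])
  have hc0 : WithLp.toLp 2 c = 0 := by
    have := hu (show (0 : ℝ) ∈ Icc 0 1 by simp)
    simpa [h0] using this.symm
  rw [hu hξ, hc0]
  exact zero_add _

/-- The inflow condition fixes the integration constant. It turns the domain of the transport
operator into the range of the Volterra operator. -/
theorem toL2_eq_volterra (ζ : H1 n) (h0 : rep ζ 0 = 0) : toL2 ζ = volterra n (wderiv ζ) := by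
  apply Lp.ext
  filter_upwards [toL2_ae_eq_rep ζ, volterra_ae_eq (wderiv ζ), ae_restrict_mem measurableSet_Ioo]
    with ξ h1 h2 hξ
  rw [h1, h2, rep_eq_primitive ζ h0 (Ioo_subset_Icc_self hξ)]

theorem norm_rep_one_le (ζ : H1 n) (h0 : rep ζ 0 = 0) : ‖rep ζ 1‖ ≤ ‖wderiv ζ‖ := by
  rw [rep_eq_primitive ζ h0 (by simp)]
  exact norm_primitive_le _ (by simp)

theorem norm_le_add (ζ : H1 n) : ‖ζ‖ ≤ ‖toL2 ζ‖ + ‖wderiv ζ‖ := by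
  rw [← Submodule.norm_coe, WithLp.prod_norm_eq_of_L2]
  refine Real.sqrt_le_iff.2 ⟨by positivity, ?_⟩
  have h1 := mul_nonneg (norm_nonneg (toL2 ζ)) (norm_nonneg (wderiv ζ))
  simp only [toL2, wderiv] at *
  nlinarith

theorem norm_wderiv_le (ζ : H1 n) : ‖wderiv ζ‖ ≤ ‖ζ‖ := by
  rw [← Submodule.norm_coe, WithLp.prod_norm_eq_of_L2]
  apply Real.le_sqrt_of_sq_le
  exact le_add_of_nonneg_left (by positivity)

end H1

/-! ### Bounds along trajectories -/

theorem norm_mulVecL_mul_le {m n k : ℕ} (M : Matrix (Fin m) (Fin n) ℝ)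
    (N : Matrix (Fin n) (Fin k) ℝ) : ‖mulVecL (M * N)‖ ≤ ‖mulVecL M‖ * ‖mulVecL N‖ := by
  have e : mulVecL (M * N) = (mulVecL M).comp (mulVecL N) :=
    ContinuousLinearMap.ext fun x => mulVecL_mul M N x
  rw [e]
  exact ContinuousLinearMap.opNorm_comp_le _ _

/-- `mulVecL` for square matrices, as a linear map. -/
noncomputable def mulVecLin (n : ℕ) : Matrix (Fin n) (Fin n) ℝ →ₗ[ℝ] (Vec n →L[ℝ] Vec n) :=
  (LinearMap.toContinuousLinearMap : (Vec n →ₗ[ℝ] Vec n) ≃ₗ[ℝ] _).toLinearMap ∘ₗ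
    (Matrix.toEuclideanLin : Matrix (Fin n) (Fin n) ℝ ≃ₗ[ℝ] _).toLinearMap

theorem continuous_mulVecL {n : ℕ} :
    Continuous (mulVecL : Matrix (Fin n) (Fin n) ℝ → Vec n →L[ℝ] Vec n) :=
  (mulVecLin n).continuous_of_finiteDimensional

theorem exists_norm_mulVecL_diagonal_le (n : ℕ) :
    ∃ D : ℝ, 0 ≤ D ∧ ∀ d : Vec n, ‖mulVecL (Matrix.diagonal d)‖ ≤ D * ‖d‖ := by
  let T : Vec n →ₗ[ℝ] (Vec n →L[ℝ] Vec n) := mulVecLin n ∘ₗ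
    (Matrix.diagonalLinearMap (Fin n) ℝ ℝ) ∘ₗ (WithLp.linearEquiv 2 ℝ (Fin n → ℝ)).toLinearMap
  exact ⟨_, norm_nonneg _, fun d => (LinearMap.toContinuousLinearMap T).le_opNorm d⟩

theorem BoundedOnHalfLine.comp_continuous {n : ℕ} {F : Type*} [NormedAddCommGroup F]
    {v : ℝ → Vec n} (hv : BoundedOnHalfLine v) {f : Vec n → F} (hf : Continuous f) :
    BoundedOnHalfLine fun t => f (v t) := by
  obtain ⟨C, hC⟩ := hv
  obtain ⟨K, hK⟩ := (isCompact_closedBall (0 : Vec n) C).exists_bound_of_continuousOn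
    hf.continuousOn
  exact ⟨K, fun t ht => hK _ (mem_closedBall_zero_iff.2 (hC t ht))⟩

theorem exists_norm_integral_kernel_le {n : ℕ} {K : ℝ → Matrix (Fin n) (Fin n) ℝ}
    (hK : ContinuousOn K (Icc 0 1)) :
    ∃ C : ℝ, 0 ≤ C ∧ ∀ ζ : L2 n, ‖∫ ξ, mulVecL (K ξ) (ζ ξ) ∂unitMeasure‖ ≤ C * ‖ζ‖ := by
  obtain ⟨C, hC⟩ := isCompact_Icc.exists_bound_of_continuousOn
    (continuous_mulVecL.comp_continuousOn hK)
  have hC0 : 0 ≤ C := (norm_nonneg _).trans (hC 0 (by simp))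
  refine ⟨C, hC0, fun ζ => (norm_integral_le_integral_norm _).trans ?_⟩
  calc ∫ ξ, ‖mulVecL (K ξ) (ζ ξ)‖ ∂unitMeasure ≤ ∫ ξ, C * ‖ζ ξ‖ ∂unitMeasure := by
        refine integral_mono_ae (integrable_kernel hK ζ).norm
          ((integrable_L2 ζ).norm.const_mul C) ?_
        filter_upwards [ae_restrict_mem measurableSet_Ioo] with ξ hξ
        exact (ContinuousLinearMap.le_opNorm _ _).trans
          (mul_le_mul_of_nonneg_right (hC ξ (Ioo_subset_Icc_self hξ)) (norm_nonneg _))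
    _ = C * ∫ ξ, ‖ζ ξ‖ ∂unitMeasure := integral_const_mul _ _
    _ ≤ C * ‖ζ‖ := by gcongr; exact integral_norm_le_norm ζ

/-- N is multiplication by Λ^(-1/2): in the inner product it defines, the velocities cancel and all
components are transported at unit speed. -/
theorem exists_transport_weight {n : ℕ} {lam : Fin n → ℝ} (hlam : ∀ i, 0 < lam i) :
    ∃ N N' : L2 n →L[ℝ] L2 n, (∀ f, N' (N f) = f) ∧ ∀ f g : L2 n,
      inner ℝ (N f) (N ((mulVecL (Matrix.diagonal lam)).compLpL 2 unitMeasure g))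
        = inner ℝ f g := by
  let d : Matrix (Fin n) (Fin n) ℝ := Matrix.diagonal fun i => (Real.sqrt (lam i))⁻¹
  let d' : Matrix (Fin n) (Fin n) ℝ := Matrix.diagonal fun i => Real.sqrt (lam i)
  have hs : ∀ i, Real.sqrt (lam i) ≠ 0 := fun i => (Real.sqrt_pos.2 (hlam i)).ne'
  refine ⟨(mulVecL d).compLpL 2 unitMeasure, (mulVecL d').compLpL 2 unitMeasure, fun f => ?_,
    fun f g => ?_⟩
  · apply Lp.ext
    filter_upwards [(mulVecL d').coeFn_compLpL ((mulVecL d).compLpL 2 unitMeasure f),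
      (mulVecL d).coeFn_compLpL f] with ξ h1 h2
    rw [h1, h2]
    ext i
    simp [mulVecL, d, d', Matrix.mulVec_diagonal, hs]
  · rw [L2.inner_def, L2.inner_def]
    apply integral_congr_ae
    filter_upwards [(mulVecL d).coeFn_compLpL ((mulVecL (Matrix.diagonal lam)).compLpL 2
      unitMeasure g), (mulVecL d).coeFn_compLpL f,
      (mulVecL (Matrix.diagonal lam)).coeFn_compLpL g] with ξ h1 h2 h3
    rw [h1, h2, h3]
    simp only [PiLp.inner_apply]
    refine Finset.sum_congr rfl fun i _ => ?_
    have h4 : lam i = Real.sqrt (lam i) * Real.sqrt (lam i) :=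
      (Real.mul_self_sqrt (hlam i).le).symm
    simp only [mulVecL, d, LinearMap.coe_toContinuousLinearMap', Matrix.toLpLin_apply,
      Matrix.mulVec_diagonal, RCLike.inner_apply, conj_trivial]
    have h5 := hs i
    generalize Real.sqrt (lam i) = r at h4 h5
    rw [h4]
    field_simp

namespace IsClassicalCurve

variable {nX nz : ℕ} {w : ℝ → SpaceY nX nz}

theorem continuousOn_fst (h : IsClassicalCurve w) : ContinuousOn (fun t => (w t).fst) (Ici 0) :=
  (WithLp.prod_continuous_ofLp 2 _ _).fst.comp_continuousOn h.continuousOn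

theorem continuousOn_toL2 (h : IsClassicalCurve w) :
    ContinuousOn (fun t => H1.toL2 (w t).snd) (Ici 0) := by
  have h1 : ContinuousOn (fun t => ((w t).snd : WithLp 2 (L2 nz × L2 nz))) (Ici 0) :=
    continuous_subtype_val.comp_continuousOn
      ((WithLp.prod_continuous_ofLp 2 _ _).snd.comp_continuousOn h.continuousOn)
  exact (WithLp.prod_continuous_ofLp 2 _ _).fst.comp_continuousOn h1

theorem toL2_eq_volterra (h : IsClassicalCurve w) {t : ℝ} (ht : 0 ≤ t) :
    H1.toL2 (w t).snd = volterra nz (H1.wderiv (w t).snd) :=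
  H1.toL2_eq_volterra _ (h.mem_domA t ht)

end IsClassicalCurve

theorem norm_fst_le {nX nz : ℕ} (p : SpaceY nX nz) : ‖p.fst‖ ≤ ‖p‖ := by
  rw [WithLp.prod_norm_eq_of_L2]
  exact Real.le_sqrt_of_sq_le (le_add_of_nonneg_right (by positivity))

theorem norm_snd_le {nX nz : ℕ} (p : SpaceY nX nz) : ‖p.snd‖ ≤ ‖p‖ := by
  rw [WithLp.prod_norm_eq_of_L2]
  exact Real.le_sqrt_of_sq_le (le_add_of_nonneg_left (by positivity))

theorem norm_le_fst_add_snd {nX nz : ℕ} (p : SpaceY nX nz) : ‖p‖ ≤ ‖p.fst‖ + ‖p.snd‖ := by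
  rw [WithLp.prod_norm_eq_of_L2]
  refine Real.sqrt_le_iff.2 ⟨by positivity, ?_⟩
  nlinarith [mul_nonneg (norm_nonneg p.fst) (norm_nonneg p.snd)]

/-! ### The cascade from parameter error to observer error -/

namespace System

variable {nX nz nU : ℕ} (S : System nX nz nU)

/-- The trace ζ(1) is not controlled by the L² norm, so the bound is by the derivative; this is why
the PDE estimate must come before the ODE one. -/
theorem exists_norm_opK₁_le : ∃ C : ℝ, 0 ≤ C ∧ ∀ ζ : H1 nz, H1.rep ζ 0 = 0 →
    ‖S.opK₁ ζ‖ ≤ C * ‖H1.wderiv ζ‖ := by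
  obtain ⟨C, hC0, hC⟩ := exists_norm_integral_kernel_le S.K₁_continuousOn
  refine ⟨C * ‖volterra nz‖ + ‖mulVecL S.K₂‖, by positivity, fun ζ h0 => ?_⟩
  refine (norm_add_le _ _).trans ?_
  rw [add_mul]
  gcongr
  · refine (hC _).trans ?_
    rw [mul_assoc, H1.toL2_eq_volterra ζ h0]
    gcongr
    exact ContinuousLinearMap.le_opNorm _ _
  · refine (ContinuousLinearMap.le_opNorm _ _).trans ?_
    gcongr
    exact H1.norm_rep_one_le ζ h0

variable {S} {U : ℝ → Vec nU} {w : ℝ → SpaceY nX nz}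

theorem bounded_vel (hw : BoundedOnHalfLine w) (hU : BoundedOnHalfLine U) :
    BoundedOnHalfLine fun t => S.vel (w t).fst (U t) := by
  rw [← expBounded_zero_iff] at *
  exact ((hw.of_le_mul zero_le_one fun t _ => by rw [one_mul]; exact norm_fst_le _).clm_apply
    (mulVecL S.A₂)).add (hU.clm_apply (mulVecL S.G₂))

theorem bounded_regressor (hSig : Continuous S.Sig) (hh₂ : Continuous S.h₂)
    (hv : BoundedOnHalfLine fun t => S.vel (w t).fst (U t)) :
    BoundedOnHalfLine (S.regressor U w) := by
  have hf : Continuous fun v => -mulVecL (S.Lam * S.Sig v * S.Lam⁻¹) (S.h₂ v) :=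
    ((continuous_mulVecL.comp
      ((continuous_const.matrix_mul hSig).matrix_mul continuous_const)).clm_apply hh₂).neg
  refine (hv.comp_continuous hf).imp fun C hC t ht => ?_
  simpa [regressor, meas₁] using hC t ht

theorem continuousOn_meas₁ (hh₂ : Continuous S.h₂) (hU : ContinuousOn U (Ici 0))
    (hw : IsClassicalCurve w) : ContinuousOn (S.meas₁ U w) (Ici 0) :=
  hh₂.comp_continuousOn (((mulVecL S.A₂).continuous.comp_continuousOn hw.continuousOn_fst).add
    ((mulVecL S.G₂).continuous.comp_continuousOn hU))

theorem IsPlantSolution.differentiableAt_meas₁ (hw : S.IsPlantSolution U w)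
    (hh₂ : Differentiable ℝ S.h₂) (hU : DifferentiableOn ℝ U (Ici 0)) {t : ℝ} (ht : 0 < t) :
    DifferentiableAt ℝ (S.meas₁ U w) t := by
  have h1 : DifferentiableAt ℝ (fun s => mulVecL S.A₂ (w s).fst) t :=
    (mulVecL S.A₂).differentiableAt.comp t (hw.ode t ht).differentiableAt
  have h2 : DifferentiableAt ℝ (fun s => mulVecL S.G₂ (U s)) t :=
    (mulVecL S.G₂).differentiableAt.comp t (hU.differentiableAt (Ici_mem_nhds ht))
  exact (hh₂ _).comp t (h1.add h2)

variable {L₁ : Matrix (Fin nX) (Fin nz) ℝ} {θhat : ℝ → Vec nz} {e : ℝ → SpaceY nX nz} {c : ℝ}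

/-- The spatial derivative of the distributed observer error is controlled by the parameter
error. -/
theorem IsErrorSolution.expBounded_wderiv (he : S.IsErrorSolution L₁ U w θhat e) (hc : 0 ≤ c)
    (hw : IsClassicalCurve w) (hwb : BoundedOnHalfLine w)
    (hsig : BoundedOnHalfLine fun t => mulVecL (S.Sig (S.vel (w t).fst (U t))))
    (hθ : BoundedOnHalfLine θhat) (hθe : ExpBounded c fun t => S.θ - θhat t) :
    ExpBounded c fun t => H1.wderiv (e t).snd := by
  obtain ⟨D, hD0, hD⟩ := exists_norm_mulVecL_diagonal_le nz
  obtain ⟨N, N', hN, hNL⟩ := exists_transport_weight S.lam_pos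
  obtain ⟨K, hK0, hK⟩ : ∃ K : ℝ, 0 ≤ K ∧ ∀ t, 0 ≤ t → ‖mulVecL
      (Matrix.diagonal (θhat t) * S.Sig (S.vel (w t).fst (U t)))‖ ≤ K := by
    rw [← expBounded_zero_iff] at hθ
    have h1 : ExpBounded 0 fun t => mulVecL (Matrix.diagonal (θhat t)) :=
      hθ.of_le_mul hD0 fun t _ => hD _
    have h2 : ExpBounded 0 fun t => mulVecL
        (Matrix.diagonal (θhat t) * S.Sig (S.vel (w t).fst (U t))) :=
      h1.of_le_bounded_mul hsig fun t _ => (norm_mulVecL_mul_le _ _).trans_eq (mul_comm _ _)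
    obtain ⟨K, hK0, hK⟩ := h2.exists_nonneg
    exact ⟨K, hK0, by simpa using hK⟩
  -- The source Θ̃Σ(v)z equals V applied to Θ̃Σ(v)∂z/∂ξ, and the plant's bound in 𝒴 controls ∂z/∂ξ.
  have hg : ExpBounded c fun t => (mulVecL (Matrix.diagonal (S.θ - θhat t)
      * S.Sig (S.vel (w t).fst (U t)))).compLp (H1.wderiv (w t).snd) := by
    have h1 : ExpBounded c fun t => mulVecL (Matrix.diagonal (S.θ - θhat t)) :=
      hθe.of_le_mul hD0 fun t _ => hD _
    have h2 : ExpBounded c fun t => mulVecL (Matrix.diagonal (S.θ - θhat t)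
        * S.Sig (S.vel (w t).fst (U t))) :=
      h1.of_le_bounded_mul hsig fun t _ => (norm_mulVecL_mul_le _ _).trans_eq (mul_comm _ _)
    refine h2.of_le_bounded_mul hwb fun t _ => (ContinuousLinearMap.norm_compLp_le _ _).trans ?_
    rw [mul_comm]
    gcongr
    exact (H1.norm_wderiv_le _).trans (norm_snd_le _)
  -- The exponent of the weight is also the accretivity constant, so it is taken to be exactly the
  -- dissipation required.
  have hκ : 0 ≤ (K + c + 1) * ‖N‖ ^ 2 := by positivity
  refine expBounded_of_transport (V := volterra nz) (M := expWeight nz hκ) (N := N) (N' := N')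
    (L := (mulVecL S.Lam).compLpL 2 unitMeasure)
    (F := fun t => (mulVecL (Matrix.diagonal (θhat t)
      * S.Sig (S.vel (w t).fst (U t)))).compLpL 2 unitMeasure)
    (z := fun t => H1.toL2 (e t).snd) hc volterra_accretive (fun x hx => volterra_injective hx)
    (weighted_volterra_accretive hκ) (norm_expWeight_le hκ) (Real.exp_pos _).le
    (norm_le_expWeight hκ) hN hNL (compLp_volterra _) (compLp_expWeight hκ _)
    (fun t => compLp_volterra _) (fun t => compLp_expWeight hκ _)
    (fun t ht => (ContinuousLinearMap.norm_compLpL_le _).trans (hK t ht)) le_rfl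
    (fun t ht => he.regular.toL2_eq_volterra ht) he.regular.continuousOn_toL2
    (fun t ht => ?_) hg
  rw [← compLp_volterra, ← hw.toL2_eq_volterra ht.le]
  exact he.pde t ht

/-- Every sufficiently small decay rate of the parameter error is inherited by the observer
error. -/
theorem exists_expBounded_of_isErrorSolution (hL₁ : IsHurwitz (S.A₁ + L₁ * S.A₂))
    (he : S.IsErrorSolution L₁ U w θhat e)
    (hw : IsClassicalCurve w) (hwb : BoundedOnHalfLine w)
    (hsig : BoundedOnHalfLine fun t => mulVecL (S.Sig (S.vel (w t).fst (U t))))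
    (hθ : BoundedOnHalfLine θhat) :
    ∃ c₀ > (0 : ℝ), ∀ c, 0 ≤ c → c ≤ c₀ → (ExpBounded c fun t => S.θ - θhat t) →
      ExpBounded c e := by
  obtain ⟨c₀, hc₀, H⟩ := hL₁.exists_expBounded
  obtain ⟨D, hD0, hD⟩ := exists_norm_mulVecL_diagonal_le nz
  obtain ⟨C₁, hC₁0, hC₁⟩ := S.exists_norm_opK₁_le
  obtain ⟨C₂, hC₂0, hC₂⟩ := exists_norm_integral_kernel_le S.K₃_continuousOn
  refine ⟨c₀, hc₀, fun c hc hcc₀ hθe => ?_⟩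
  have hy := he.expBounded_wderiv hc hw hwb hsig hθ hθe
  have hz : ExpBounded c fun t => H1.toL2 (e t).snd :=
    hy.of_le_mul (norm_nonneg (volterra nz)) fun t ht => by
      rw [he.regular.toL2_eq_volterra ht]
      exact ContinuousLinearMap.le_opNorm _ _
  have hzw : BoundedOnHalfLine fun t => H1.toL2 (w t).snd := by
    rw [← expBounded_zero_iff] at hwb ⊢
    refine hwb.of_le_mul (norm_nonneg (volterra nz)) fun t ht => ?_
    rw [hw.toL2_eq_volterra ht]
    refine (ContinuousLinearMap.le_opNorm _ _).trans ?_
    gcongr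
    exact (H1.norm_wderiv_le _).trans (norm_snd_le _)
  -- The rate is left free: it is used with c for the error z̃ and with 0 for the plant state z.
  have hsigK : ∀ {c' : ℝ} {ζ : ℝ → L2 nz}, ExpBounded c' ζ → ExpBounded c' fun t =>
      mulVecL (S.Sig (S.vel (w t).fst (U t))) (S.opK₂ (ζ t)) := fun hζ =>
    (hζ.of_le_mul hC₂0 fun t _ => hC₂ _).of_le_bounded_mul hsig
      fun t _ => ContinuousLinearMap.le_opNorm _ _
  have hf₁ : ExpBounded c fun t => S.opK₁ (e t).snd :=
    hy.of_le_mul hC₁0 fun t ht => hC₁ _ (he.regular.mem_domA t ht)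
  have hf₂ : ExpBounded c fun t => mulVecL (Matrix.diagonal (θhat t))
      (mulVecL (S.Sig (S.vel (w t).fst (U t))) (S.opK₂ (H1.toL2 (e t).snd))) := by
    have h1 : BoundedOnHalfLine fun t => mulVecL (Matrix.diagonal (θhat t)) := by
      rw [← expBounded_zero_iff] at hθ ⊢
      exact hθ.of_le_mul hD0 fun t _ => hD _
    exact (hsigK hz).of_le_bounded_mul h1 fun t _ => ContinuousLinearMap.le_opNorm _ _
  have hf₃ : ExpBounded c fun t => mulVecL (Matrix.diagonal (S.θ - θhat t))
      (mulVecL (S.Sig (S.vel (w t).fst (U t))) (S.opK₂ (H1.toL2 (w t).snd))) := by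
    have h1 : ExpBounded c fun t => mulVecL (Matrix.diagonal (S.θ - θhat t)) :=
      hθe.of_le_mul hD0 fun t _ => hD _
    have h2 := expBounded_zero_iff.1 (hsigK (expBounded_zero_iff.2 hzw))
    exact h1.of_le_bounded_mul h2 fun t _ =>
      (ContinuousLinearMap.le_opNorm _ _).trans_eq (mul_comm _ _)
  have hX : ExpBounded c fun t => (e t).fst := by
    refine H c hcc₀ _ _ he.regular.continuousOn_fst (fun t ht => ?_)
      (((hf₁.add hf₂).add hf₃).clm_apply (mulVecL S.G₁))
    refine (he.ode t ht).congr_deriv ?_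
    simp only [mulVecL_mul, map_add]
    abel
  obtain ⟨a₁, h₁⟩ := hX
  obtain ⟨a₂, h₂⟩ := hz
  obtain ⟨a₃, h₃⟩ := hy
  refine ⟨a₁ + (a₂ + a₃), fun t ht => (norm_le_fst_add_snd _).trans ?_⟩
  rw [add_mul, add_mul]
  exact add_le_add (h₁ t ht) ((H1.norm_le_add _).trans (add_le_add (h₂ t ht) (h₃ t ht)))

end System

end RollingContact

/-! ### Boundedness and decay from the two rates -/

theorem theorem3 {nX nz nU : ℕ} (S : RollingContact.System nX nz nU)
    (hSig : ∀ i j, ContDiff ℝ 1 (fun v => S.Sig v i j))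
    (hh₁ : ContDiff ℝ 1 S.h₁) (hh₂ : ContDiff ℝ 1 S.h₂)
    (U : ℝ → RollingContact.Vec nU) (hU : ContDiffOn ℝ 1 U (Set.Ici 0))
    (w : ℝ → RollingContact.SpaceY nX nz) (hw : S.IsPlantSolution U w)
    (hw_bdd : RollingContact.BoundedOnHalfLine w) (hU_bdd : RollingContact.BoundedOnHalfLine U)
    (hdet : RollingContact.IsDetectable S.A₁ S.A₂)
    (ρ ψ : ℝ) (hρ : 0 < ρ) (hψ : 0 < ψ)
    (Γ : Matrix (Fin nz) (Fin nz) ℝ) (hΓ : Γ.PosDef)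
    (ζ₁ ζ₂ : ℝ → ℝ) (φ : ℝ → RollingContact.Vec nz) (R : ℝ → Matrix (Fin nz) (Fin nz) ℝ)
    (Q θhat : ℝ → RollingContact.Vec nz)
    (hid : S.IsIdentifier ρ ψ Γ U w ζ₁ ζ₂ φ R Q θhat)
    (L₁ : Matrix (Fin nX) (Fin nz) ℝ) (hL₁ : RollingContact.IsHurwitz (S.A₁ + L₁ * S.A₂))
    (e : ℝ → RollingContact.SpaceY nX nz) (he : S.IsErrorSolution L₁ U w θhat e) :
    RollingContact.BoundedOnHalfLine e ∧
      (RollingContact.PersistentlyExciting φ →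
        ∃ M > (0 : ℝ), ∃ σ > (0 : ℝ), ∀ t, 0 ≤ t → ‖e t‖ ≤ M * Real.exp (-σ * t)) := by
  have hSigc : Continuous S.Sig := continuous_matrix fun i j => (hSig i j).continuous
  have hv := RollingContact.System.bounded_vel (S := S) hw_bdd hU_bdd
  have hsig := hv.comp_continuous (RollingContact.continuous_mulVecL.comp hSigc)
  obtain ⟨hθe, hpe⟩ := hid.parameter_error hρ hψ hΓ
    (RollingContact.System.continuousOn_meas₁ hh₂.continuous hU.continuousOn hw.regular)
    (fun t ht => hw.differentiableAt_meas₁ (hh₂.differentiable one_ne_zero)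
      (hU.differentiableOn one_ne_zero) ht)
    (RollingContact.System.bounded_regressor hSigc hh₂.continuous hv)
  rw [← RollingContact.expBounded_zero_iff] at hθe
  have hθ : RollingContact.BoundedOnHalfLine θhat := by
    obtain ⟨C, hC⟩ := hθe
    refine ⟨‖S.θ‖ + C, fun t ht => ?_⟩
    have h1 := hC t ht
    have h2 := norm_sub_le S.θ (S.θ - θhat t)
    simp only [sub_sub_cancel, neg_zero, zero_mul, Real.exp_zero, mul_one] at h1 h2
    linarith
  obtain ⟨c₀, hc₀, H⟩ :=
    RollingContact.System.exists_expBounded_of_isErrorSolution hL₁ he hw.regular hw_bdd hsig hθ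
  -- Boundedness is the cascade estimate at rate 0; the decay claim uses the same estimate at rate
  -- `min c c₀`.
  refine ⟨RollingContact.expBounded_zero_iff.1 (H 0 le_rfl hc₀.le hθe), fun hφ => ?_⟩
  obtain ⟨c, hc, hcθ⟩ := hpe hφ
  have hm : 0 < min c c₀ := lt_min hc hc₀
  obtain ⟨M, hM0, hM⟩ :=
    (H (min c c₀) hm.le (min_le_right _ _) (hcθ.mono (min_le_left _ _))).exists_nonneg
  -- M is only known to be nonnegative; adding 1 makes the constant strictly positive.
  refine ⟨M + 1, by linarith, min c c₀, hm, fun t ht => (hM t ht).trans ?_⟩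
  gcongr
  linarith
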